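/- Let $d$ be a finite nonnegative integer. All operators are bounded and all Hilbert spaces are complex. Let $H^2_d$ be the completion of $\mathbb{C}[z_1,\dots,z_d]$ in the inner product with $\langle z^\alpha,z^\beta\rangle=0$ for $\alpha\ne\beta$ and $\langle z^\alpha,z^\alpha\rangle=\alpha!/|\alpha|!$, and let $S=(S_1,\dots,S_d)$ be the $d$-shift on it, $S_i f=z_i f$. A $d$-contraction is a tuple $T=(T_1,\dots,T_d)$ of commuting operators on a Hilbert space $H$ with $\sum_i T_iT_i^*\le I$. Put $\Theta_T(A)=\sum_i T_iAT_i^*$ and $\Delta_T=\sqrt{I-\Theta_T(I)}$. $T$ is pure if $\Theta_T^k(I)\to0$ strongly as $k\to\infty$, and $\operatorname{rank}(T)=\dim\overline{\Delta_TH}\in\{0,1,2,\dots,\infty\}$. A spherical unitary is a tuple $Z=(Z_1,\dots,Z_d)$ of commuting normal operators on a Hilbert space $H_Z$ with $\sum_iZ_iZ_i^*=I$; the case $H_Z=\{0\}$ is allowed, and then $Z$ is called nil. Tuples $A$ on $G$ and $B$ on $G'$ are unitarily equivalent if there is a unitary $U:G\to G'$ with $UA_iU^*=B_i$ for all $i$.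 For a tuple $A$ on $G$, a closed subspace $K\subseteq G$ is co-invariant if $A_i^*K\subseteq K$ for all $i$, and it is full if $G$ is the closed linear span of $C^*(1,A)K$, where $C^*(1,A)$ is the unital $C^*$-algebra generated by $A_1,\dots,A_d$; the compression of $A$ to $K$ is the tuple $P_KA_i|_K$. For $n\in\{0,1,2,\dots,\infty\}$, where $\infty$ is countable infinity, $n\cdot S$ is the direct sum of $n$ copies of $S$, acting on the direct sum $n\cdot H^2_d$ of $n$ copies of $H^2_d$. **Theorem.** Let $T$ be a $d$-contraction on a separable Hilbert space. Then there are $n\in\{0,1,2,\dots,\infty\}$, a spherical unitary $Z$ on a separable Hilbert space $H_Z$, and a closed subspace $K\subseteq n\cdot H^2_d\oplus H_Z$ that is co-invariant and full for $n\cdot S\oplus Z$, such that $T$ is unitarily equivalent to the compression of $n\cdot S\oplus Z$ to $K$. The triple $(n,Z,K)$ is determined uniquely, up to unitary equivalence, by the unitary equivalence class of $T$: if $(n,Z,K)$ and $(n',Z',K')$ are such triples for $T$ and for a tuple $T'$ unitarily equivalent to $T$, then $n=n'$ and there are unitaries $W:n\cdot H^2_d\to n'\cdot H^2_d$ and $V:H_Z\to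 H_{Z'}$ with $W(n\cdot S_i)=(n'\cdot S_i)W$ and $VZ_i=Z'_iV$ for all $i$ and $(W\oplus V)K=K'$. Moreover, for every such triple for $T$, $Z$ is nil (that is, $H_Z=\{0\}$) if and only if $T$ is pure, and $n=\operatorname{rank}(T)$. -/

import Mathlib

universe u u' v w

noncomputable section

open Filter Topology
open scoped InnerProductSpace

namespace DruryArveson


/-! ## The Drury-Arveson space as the graded completion of the polynomials -/

/-- The weight `α! / |α|!` of the multi-index `α`. -/
def weight {d : ℕ} (α : Fin d →₀ ℕ) : ℝ :=
  ((∏ i, (α i).factorial : ℕ) : ℝ) / (((∑ i, α i).factorial : ℕ) : ℝ)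

theorem weight_pos {d : ℕ} (α : Fin d →₀ ℕ) : 0 < weight α := by
  unfold weight
  have h1 : 0 < ∏ i, (α i).factorial := Finset.prod_pos fun i _ => Nat.factorial_pos _
  have h2 := Nat.factorial_pos (∑ i, α i)
  positivity

/-- The polynomial algebra `ℂ[z₁, …, z_d]`, to be equipped with the Drury-Arveson inner product. -/
def Poly (d : ℕ) : Type := MvPolynomial (Fin d) ℂ

instance (d : ℕ) : CommRing (Poly d) := inferInstanceAs (CommRing (MvPolynomial (Fin d) ℂ))

instance (d : ℕ) : Algebra ℂ (Poly d) := inferInstanceAs (Algebra ℂ (MvPolynomial (Fin d) ℂ))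

/-- The coefficient of `z ^ α` in `p`. -/
def Poly.coeff {d : ℕ} (p : Poly d) (α : Fin d →₀ ℕ) : ℂ := MvPolynomial.coeff α p

/-- The finite set of multi-indices with a nonzero coefficient in `p`. -/
def Poly.support {d : ℕ} (p : Poly d) : Finset (Fin d →₀ ℕ) := MvPolynomial.support p

/-- The coordinate function `z_i`. -/
def Poly.z {d : ℕ} (i : Fin d) : Poly d := (MvPolynomial.X i : MvPolynomial (Fin d) ℂ)

theorem Poly.coeff_add {d : ℕ} (p q : Poly d) (α : Fin d →₀ ℕ) :
    (p + q).coeff α = p.coeff α + q.coeff α := MvPolynomial.coeff_add α p q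

theorem Poly.coeff_smul {d : ℕ} (c : ℂ) (p : Poly d) (α : Fin d →₀ ℕ) :
    (c • p).coeff α = c * p.coeff α := MvPolynomial.coeff_smul α c p

theorem Poly.coeff_eq_zero {d : ℕ} {p : Poly d} {α : Fin d →₀ ℕ} (h : α ∉ p.support) :
    p.coeff α = 0 := MvPolynomial.notMem_support_iff.mp h

/-- The inner product in which distinct monomials are orthogonal and
`⟪z ^ α, z ^ α⟫ = α! / |α|!`; it is conjugate-linear in the first variable. -/
def polyInner {d : ℕ} (p q : Poly d) : ℂ :=
  ∑ α ∈ p.support, (weight α : ℂ) * (starRingEnd ℂ (p.coeff α) * q.coeff α)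

theorem polyInner_eq_sum {d : ℕ} (p q : Poly d) (s : Finset (Fin d →₀ ℕ))
    (hs : p.support ⊆ s ∨ q.support ⊆ s) :
    polyInner p q = ∑ α ∈ s, (weight α : ℂ) * (starRingEnd ℂ (p.coeff α) * q.coeff α) := by
  classical
  unfold polyInner
  have h1 := Finset.sum_subset (Finset.subset_union_left : p.support ⊆ p.support ∪ s)
    (f := fun α => (weight α : ℂ) * (starRingEnd ℂ (p.coeff α) * q.coeff α)) fun α _ h => by
      simp only [Poly.coeff_eq_zero h, map_zero, zero_mul, mul_zero]
  have h2 := Finset.sum_subset (Finset.subset_union_right : s ⊆ p.support ∪ s)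
    (f := fun α => (weight α : ℂ) * (starRingEnd ℂ (p.coeff α) * q.coeff α)) fun α _ h => by
      rcases hs with hs | hs
      · simp only [Poly.coeff_eq_zero (p := p) (fun h' => h (hs h')), map_zero, zero_mul, mul_zero]
      · simp only [Poly.coeff_eq_zero (p := q) (fun h' => h (hs h')), mul_zero]
  exact h1.trans h2.symm

theorem polyInner_self {d : ℕ} (p : Poly d) (s : Finset (Fin d →₀ ℕ)) (hs : p.support ⊆ s) :
    polyInner p p = ((∑ α ∈ s, weight α * ‖p.coeff α‖ ^ 2 : ℝ) : ℂ) := by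
  rw [polyInner_eq_sum p p s (Or.inl hs)]
  push_cast
  refine Finset.sum_congr rfl fun α _ => ?_
  rw [mul_comm (starRingEnd ℂ _), Complex.mul_conj, Complex.normSq_eq_norm_sq]
  push_cast
  rfl

abbrev polyCore (d : ℕ) : InnerProductSpace.Core ℂ (Poly d) where
  inner := polyInner
  conj_inner_symm p q := by
    rw [polyInner_eq_sum q p q.support (Or.inl subset_rfl),
      polyInner_eq_sum p q q.support (Or.inr subset_rfl), map_sum]
    refine Finset.sum_congr rfl fun α _ => ?_
    simp only [map_mul, Complex.conj_ofReal, Complex.conj_conj]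
    ring
  re_inner_nonneg p := by
    rw [polyInner_self p p.support subset_rfl]
    simp only [RCLike.re_to_complex, Complex.ofReal_re]
    exact Finset.sum_nonneg fun α _ => mul_nonneg (weight_pos α).le (sq_nonneg _)
  add_left p q r := by
    rw [polyInner_eq_sum (p + q) r r.support (Or.inr subset_rfl),
      polyInner_eq_sum p r r.support (Or.inr subset_rfl),
      polyInner_eq_sum q r r.support (Or.inr subset_rfl), ← Finset.sum_add_distrib]
    refine Finset.sum_congr rfl fun α _ => ?_
    rw [Poly.coeff_add, map_add]
    ring
  smul_left p q c := by
    rw [polyInner_eq_sum (c • p) q q.support (Or.inr subset_rfl),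
      polyInner_eq_sum p q q.support (Or.inr subset_rfl), Finset.mul_sum]
    refine Finset.sum_congr rfl fun α _ => ?_
    rw [Poly.coeff_smul, map_mul]
    ring
  definite p h := by
    rw [polyInner_self p p.support subset_rfl, Complex.ofReal_eq_zero,
      Finset.sum_eq_zero_iff_of_nonneg
        (fun α _ => mul_nonneg (weight_pos α).le (sq_nonneg _))] at h
    refine MvPolynomial.ext _ _ fun α => ?_
    by_cases hα : α ∈ p.support
    · have h' : p.coeff α = 0 := by simpa [(weight_pos α).ne'] using h α hα
      exact h'
    · exact Poly.coeff_eq_zero hα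

instance (d : ℕ) : NormedAddCommGroup (Poly d) := (polyCore d).toNormedAddCommGroup

instance (d : ℕ) : InnerProductSpace ℂ (Poly d) := InnerProductSpace.ofCore (polyCore d).toCore

/-- The Drury-Arveson space `H²_d`: the completion of `ℂ[z₁, …, z_d]` in the inner product with
`⟪z ^ α, z ^ β⟫ = 0` for `α ≠ β` and `⟪z ^ α, z ^ α⟫ = α! / |α|!`. -/
abbrev H2 (d : ℕ) : Type := UniformSpace.Completion (Poly d)

/-! ## The `d`-shift -/

theorem weight_add_single_le {d : ℕ} (α : Fin d →₀ ℕ) (i : Fin d) :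
    weight (α + Finsupp.single i 1) ≤ weight α := by
  classical
  have h1 : ∏ j, ((α + Finsupp.single i 1 : Fin d →₀ ℕ) j).factorial = (α i + 1) * ∏ j, (α j).factorial := by
    rw [← Finset.mul_prod_erase _ _ (Finset.mem_univ i),
      ← Finset.mul_prod_erase _ (fun j => (α j).factorial) (Finset.mem_univ i), ← mul_assoc]
    congr 1
    · simp [Nat.factorial_succ]
    · refine Finset.prod_congr rfl fun j hj => ?_
      have : i ≠ j := (Finset.ne_of_mem_erase hj).symm
      simp [this]
  have h2 : ∑ j, (α + Finsupp.single i 1 : Fin d →₀ ℕ) j = (∑ j, α j) + 1 := by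
    simp [Finset.sum_add_distrib, Finsupp.single_apply]
  have h3 : α i ≤ ∑ j, α j := Finset.single_le_sum (fun _ _ => Nat.zero_le _) (Finset.mem_univ i)
  unfold weight
  rw [h1, h2, Nat.factorial_succ]
  push_cast
  have h4 : (0 : ℝ) < ((∑ j, α j).factorial : ℝ) := by exact_mod_cast Nat.factorial_pos _
  have h5 : (α i : ℝ) ≤ ∑ j, (α j : ℝ) := by exact_mod_cast h3
  have h6 : (0 : ℝ) ≤ ∏ j, ((α j).factorial : ℝ) := Finset.prod_nonneg fun _ _ => by positivity
  have h7 : (0 : ℝ) ≤ (α i : ℝ) := by positivity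
  rw [div_le_div_iff₀ (by positivity) h4]
  nlinarith [mul_nonneg (mul_nonneg (sub_nonneg.mpr h5) h6) h4.le]

theorem norm_sq_eq {d : ℕ} (p : Poly d) (s : Finset (Fin d →₀ ℕ)) (hs : p.support ⊆ s) :
    ‖p‖ ^ 2 = ∑ α ∈ s, weight α * ‖p.coeff α‖ ^ 2 := by
  have h : ‖p‖ ^ 2 = (inner ℂ p p : ℂ).re := (inner_self_eq_norm_sq (𝕜 := ℂ) p).symm
  rw [h]
  change (polyInner p p).re = _
  rw [polyInner_self p s hs, Complex.ofReal_re]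

theorem norm_z_mul_le {d : ℕ} (i : Fin d) (p : Poly d) : ‖Poly.z i * p‖ ≤ ‖p‖ := by
  classical
  have hsupp : (Poly.z i * p).support ⊆
      p.support.map (addLeftEmbedding (Finsupp.single i 1)) :=
    (MvPolynomial.support_X_mul i (show MvPolynomial (Fin d) ℂ from p)).subset
  refine le_of_sq_le_sq ?_ (norm_nonneg _)
  rw [norm_sq_eq _ _ hsupp, norm_sq_eq p _ subset_rfl, Finset.sum_map]
  refine Finset.sum_le_sum fun α _ => ?_
  have : (Poly.z i * p).coeff (Finsupp.single i 1 + α) = p.coeff α :=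
    MvPolynomial.coeff_X_mul α i (show MvPolynomial (Fin d) ℂ from p)
  rw [addLeftEmbedding_apply, this, add_comm]
  exact mul_le_mul_of_nonneg_right (weight_add_single_le α i) (sq_nonneg _)

/-- Multiplication by `z_i` on the polynomials. -/
def polyShift {d : ℕ} (i : Fin d) : Poly d →L[ℂ] Poly d :=
  (LinearMap.mulLeft ℂ (Poly.z i)).mkContinuous 1 fun p => by
    simpa using norm_z_mul_le i p

/-- The `d`-shift `S = (S₁, …, S_d)` on `H²_d`: the continuous extension of multiplication by the
coordinate functions on the polynomials. -/
def shift (d : ℕ) (i : Fin d) : H2 d →L[ℂ] H2 d := (polyShift i).completion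

/-! ## Tuples of operators -/

section Tuples

variable {d : ℕ} {H : Type u} [NormedAddCommGroup H] [InnerProductSpace ℂ H]

/-- `A` and `B` are unitarily equivalent: `U A_i U* = B_i` for a unitary `U`. -/
def UnitarilyEquiv {K : Type v} [NormedAddCommGroup K] [InnerProductSpace ℂ K]
    (A : Fin d → H →L[ℂ] H) (B : Fin d → K →L[ℂ] K) : Prop :=
  ∃ U : H ≃ₗᵢ[ℂ] K, ∀ i x, U (A i x) = B i (U x)

variable [CompleteSpace H]

/-- The map `Θ_T(A) = ∑ T_i A T_i*`. -/
def Theta (T : Fin d → H →L[ℂ] H) (A : H →L[ℂ] H) : H →L[ℂ] H := ∑ i, T i * A * star (T i)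

/-- A `d`-contraction: a commuting row contraction. -/
structure IsDContraction (T : Fin d → H →L[ℂ] H) : Prop where
  commute : ∀ i j, Commute (T i) (T j)
  row_contraction : ∑ i, T i * star (T i) ≤ 1

/-- `T` is pure: `Θ_T^k(I) → 0` in the strong operator topology. -/
def IsPure (T : Fin d → H →L[ℂ] H) : Prop :=
  ∀ x : H, Tendsto (fun k : ℕ => ((Theta T)^[k] 1) x) atTop (𝓝 0)

/-- The defect operator `Δ_T = √(I - Θ_T(I))`. -/
def defect (T : Fin d → H →L[ℂ] H) : H →L[ℂ] H := CFC.sqrt (1 - Theta T 1)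

/-- The defect space `𝒟_T`, the closure of the range of `Δ_T`. -/
def defectSpace (T : Fin d → H →L[ℂ] H) : Submodule ℂ H :=
  (LinearMap.range (defect T).toLinearMap).topologicalClosure

/-- The rank of `T` in `{0, 1, 2, …, ∞}`: the dimension of the defect space. For a Hilbert space,
the algebraic and the Hilbert space dimension are equal or both infinite, and all infinite values
are sent to `∞` here. -/
def rank (T : Fin d → H →L[ℂ] H) : ℕ∞ := Cardinal.toENat (Module.rank ℂ (defectSpace T))

/-- A spherical unitary: commuting normal operators with `∑ Z_i Z_i* = 1`. -/
structure IsSphericalUnitary (Z : Fin d → H →L[ℂ] H) : Prop where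
  commute : ∀ i j, Commute (Z i) (Z j)
  normal : ∀ i, IsStarNormal (Z i)
  sum_eq_one : ∑ i, Z i * star (Z i) = 1

/-- The closed subspace `K` is co-invariant for `A`. -/
def IsCoinvariant (A : Fin d → H →L[ℂ] H) (K : ClosedSubmodule ℂ H) : Prop :=
  ∀ i, ∀ x ∈ K, star (A i) x ∈ K

/-- The unital C*-algebra `C*(1, A)` generated by the tuple `A`. -/
def cstar (A : Fin d → H →L[ℂ] H) : StarSubalgebra ℂ (H →L[ℂ] H) :=
  (StarAlgebra.adjoin ℂ (Set.range A)).topologicalClosure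

/-- `K` is full for `A`: the closed linear span of `C*(1, A) K` is the whole space. -/
def IsFull (A : Fin d → H →L[ℂ] H) (K : ClosedSubmodule ℂ H) : Prop :=
  (Submodule.span ℂ {y : H | ∃ X ∈ cstar A, ∃ x ∈ K, X x = y}).topologicalClosure = ⊤

/-- The compression `P_K A_i |_K` of the tuple `A` to the closed subspace `K`. -/
def compression (A : Fin d → H →L[ℂ] H) (K : ClosedSubmodule ℂ H) (i : Fin d) :
    K.toSubmodule →L[ℂ] K.toSubmodule :=
  K.toSubmodule.orthogonalProjectionOnto ∘L A i ∘L K.toSubmodule.subtypeL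

end Tuples

/-! ## Direct sums: the tuple `n · S ⊕ Z` -/

/-- An index set with `n` elements, `n ∈ {0, 1, 2, …, ∞}`. -/
abbrev Idx (n : ℕ∞) : Type := {k : ℕ // (k : ℕ∞) < n}

/-- The Hilbert space direct sum of `n` copies of `E`. -/
abbrev Copies (n : ℕ∞) (E : Type u) [NormedAddCommGroup E] : Type u :=
  lp (fun _ : Idx n => E) 2

section Ampliation

variable {E : Type u} [NormedAddCommGroup E] [InnerProductSpace ℂ E]

theorem memLp_map (n : ℕ∞) (A : E →L[ℂ] E) (x : Copies n E) :
    Memℓp (fun k => A (x k)) 2 := by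
  have hx := (lp.memℓp x).norm.const_mul ‖A‖
  refine hx.mono' fun k => ?_
  simpa using A.le_opNorm (x k)

/-- The direct sum of `n` copies of the operator `A`. -/
def ampliation (n : ℕ∞) (A : E →L[ℂ] E) : Copies n E →L[ℂ] Copies n E :=
  LinearMap.mkContinuous
    { toFun := fun x => ⟨fun k => A (x k), memLp_map n A x⟩
      map_add' := fun x y => by ext k; exact map_add A (x k) (y k)
      map_smul' := fun c x => by ext k; exact map_smul A c (x k) } ‖A‖ fun x => by
    refine (lp.norm_mono (p := 2) (by norm_num) (y := (‖A‖ : ℂ) • x) fun k => ?_).trans ?_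
    · rw [lp.coeFn_smul, Pi.smul_apply, norm_smul, Complex.norm_real, norm_norm]
      exact A.le_opNorm (x k)
    · simpa using lp.norm_const_smul_le (p := 2) (by norm_num) (‖A‖ : ℂ) x

end Ampliation

/-- The direct sum `A ⊕ B` on the Hilbert space `E ⊕ F`. -/
def directSum {E : Type u} {F : Type v} [NormedAddCommGroup E] [InnerProductSpace ℂ E]
    [NormedAddCommGroup F] [InnerProductSpace ℂ F] (A : E →L[ℂ] E) (B : F →L[ℂ] F) :
    WithLp 2 (E × F) →L[ℂ] WithLp 2 (E × F) :=
  (WithLp.prodContinuousLinearEquiv 2 ℂ E F).symm.toContinuousLinearMap ∘L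
    A.prodMap B ∘L (WithLp.prodContinuousLinearEquiv 2 ℂ E F).toContinuousLinearMap

/-- The Hilbert space `n · H²_d ⊕ H_Z`. -/
abbrev ModelSpace (d : ℕ) (n : ℕ∞) (HZ : Type v) [NormedAddCommGroup HZ] : Type v :=
  WithLp 2 (Copies n (H2 d) × HZ)

/-- The tuple `n · S ⊕ Z`. -/
def modelTuple {d : ℕ} (n : ℕ∞) {HZ : Type v} [NormedAddCommGroup HZ] [InnerProductSpace ℂ HZ]
    (Z : Fin d → HZ →L[ℂ] HZ) (i : Fin d) : ModelSpace d n HZ →L[ℂ] ModelSpace d n HZ :=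
  directSum (ampliation n (shift d i)) (Z i)

/-- `(n, Z, K)` is a model for the tuple `T`: `Z` is a spherical unitary, `K` is a closed subspace
that is co-invariant and full for `n · S ⊕ Z`, and `T` is unitarily equivalent to the compression
of `n · S ⊕ Z` to `K`. -/
structure IsModel {d : ℕ} {H : Type u} [NormedAddCommGroup H] [InnerProductSpace ℂ H]
    (T : Fin d → H →L[ℂ] H) (n : ℕ∞) {HZ : Type v} [NormedAddCommGroup HZ]
    [InnerProductSpace ℂ HZ] [CompleteSpace HZ] (Z : Fin d → HZ →L[ℂ] HZ)
    (K : ClosedSubmodule ℂ (ModelSpace d n HZ)) : Prop where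
  spherical : IsSphericalUnitary Z
  coinvariant : IsCoinvariant (modelTuple n Z) K
  full : IsFull (modelTuple n Z) K
  equiv : UnitarilyEquiv T (compression (modelTuple n Z) K)

/-- Unitary equivalence of two triples `(n, Z, K)` and `(n', Z', K')`: `n = n'`, and there are
unitaries `W : n · H²_d → n' · H²_d` commuting with the shifts and `V : H_Z → H_Z'` carrying `Z`
to `Z'` such that `W ⊕ V` maps `K` onto `K'`. -/
def TripleEquiv {d : ℕ} (n : ℕ∞) {HZ : Type v} [NormedAddCommGroup HZ]
    [InnerProductSpace ℂ HZ] (Z : Fin d → HZ →L[ℂ] HZ) (K : ClosedSubmodule ℂ (ModelSpace d n HZ))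
    (n' : ℕ∞) {HZ' : Type w} [NormedAddCommGroup HZ'] [InnerProductSpace ℂ HZ']
    (Z' : Fin d → HZ' →L[ℂ] HZ') (K' : ClosedSubmodule ℂ (ModelSpace d n' HZ')) : Prop :=
  n = n' ∧
  ∃ (W : Copies n (H2 d) ≃ₗᵢ[ℂ] Copies n' (H2 d)) (V : HZ ≃ₗᵢ[ℂ] HZ'),
    (∀ i x, W (ampliation n (shift d i) x) = ampliation n' (shift d i) (W x)) ∧
    (∀ i y, V (Z i y) = Z' i (V y)) ∧
    ∀ x y, WithLp.toLp 2 (x, y) ∈ K ↔ WithLp.toLp 2 (W x, V y) ∈ K'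

end DruryArveson

end

open DruryArveson

noncomputable section

open Filter Topology
open scoped InnerProductSpace

/-! A model of T is the same as a map h ↦ (L h, R h) into n·H²_d ⊕ H_Z that is isometric,
intertwines T_i^* with S_i^* and Z_i^*, and whose range lies in no proper reducing subspace
(`IsDilation`).

Existence: let ε : H → ℓ²(n) have dense range and ε*ε = Δ_T², and put L h = Σ_α (|α|!/α!) z^α ⊗
ε(T*^α h). The multinomial recursion in `sum_moments_le` makes L a contraction. Since I − Σ S_i
S_i^* is the projection onto the constants, B = I − L*L satisfies Θ_T(B) = B, so the T_i^* form a
commuting spherical isometry for the semi-inner product ⟨Bx, y⟩. Such a family extends to a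
commuting normal one (`exists_sphericalUnitary_extension`): the extension lives on the reproducing
kernel space of the kernel V_w^* B V_v on words, and the positivity of that kernel follows from an
averaging argument (`exchangeable_step`, `wordForm_re_nonneg`). The adjoints of the extension form
Z, and R*R = B.

Uniqueness: T determines every Gram matrix involved. The constant terms of L have Gram matrix Δ_T²,
because Z has no defect (`inner_constTerm`), and R*R is the limit of Θ_T^m(I), because n·S is pure
(`tendsto_inner_Theta_iterate`). Fullness makes the vectors z^α ⊗ ε h and Z_w R h total
(`constTerm_total`, `sph_total`), and total families with equal Gram matrices are unitarily related.
Comparing ε with Δ_T gives n = rank T, and the limit formula for R*R shows that H_Z vanishes exactly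
when T is pure. -/

namespace DruryArveson

/-! ### Total families and their Gram matrices -/

section Gram

variable {ι : Type*} {X Y : Type*} [NormedAddCommGroup X] [InnerProductSpace ℂ X]
  [NormedAddCommGroup Y] [InnerProductSpace ℂ Y]

theorem norm_linearCombination_eq (f : ι → X) (g : ι → Y)
    (h : ∀ i j, inner ℂ (f i) (f j) = inner ℂ (g i) (g j)) (c : ι →₀ ℂ) :
    ‖Finsupp.linearCombination ℂ g c‖ = ‖Finsupp.linearCombination ℂ f c‖ := by
  have key : inner ℂ (Finsupp.linearCombination ℂ g c) (Finsupp.linearCombination ℂ g c) =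
      inner ℂ (Finsupp.linearCombination ℂ f c) (Finsupp.linearCombination ℂ f c) := by
    simp only [Finsupp.linearCombination_apply, Finsupp.sum, sum_inner, inner_sum,
      inner_smul_left, inner_smul_right, h]
  rw [@norm_eq_sqrt_re_inner ℂ, key, ← @norm_eq_sqrt_re_inner ℂ]

theorem denseRange_linearCombination {f : ι → X}
    (hf : (Submodule.span ℂ (Set.range f)).topologicalClosure = ⊤) :
    DenseRange (Finsupp.linearCombination ℂ f) := by
  have := Submodule.dense_iff_topologicalClosure_eq_top.mpr hf
  rwa [← Finsupp.range_linearCombination] at this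

/-- A total family and a family with the same Gram matrix are related by an isometry. -/
theorem exists_linearIsometry_of_inner_eq [CompleteSpace Y] (f : ι → X) (g : ι → Y)
    (hf : (Submodule.span ℂ (Set.range f)).topologicalClosure = ⊤)
    (h : ∀ i j, inner ℂ (f i) (f j) = inner ℂ (g i) (g j)) :
    ∃ U : X →ₗᵢ[ℂ] Y, ∀ i, U (f i) = g i := by
  have hd := denseRange_linearCombination hf
  have hn := norm_linearCombination_eq f g h
  have heq := LinearMap.extendOfNorm_eq hd
    (f := Finsupp.linearCombination ℂ g) ⟨1, fun c => by rw [hn, one_mul]⟩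
  refine ⟨⟨((Finsupp.linearCombination ℂ g).extendOfNorm
    (Finsupp.linearCombination ℂ f)).toLinearMap, fun x => ?_⟩, fun i => ?_⟩
  · refine hd.induction (P := fun x => ‖(Finsupp.linearCombination ℂ g).extendOfNorm
      (Finsupp.linearCombination ℂ f) x‖ = ‖x‖) ?_ (isClosed_eq (by fun_prop) (by fun_prop)) x
    rintro _ ⟨c, rfl⟩
    rw [heq, hn]
  · have := heq (Finsupp.single i 1)
    simpa using this

/-- Two total families with the same Gram matrix are related by a unitary. -/
theorem exists_linearIsometryEquiv_of_inner_eq [CompleteSpace X] [CompleteSpace Y]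
    (f : ι → X) (g : ι → Y)
    (hf : (Submodule.span ℂ (Set.range f)).topologicalClosure = ⊤)
    (hg : (Submodule.span ℂ (Set.range g)).topologicalClosure = ⊤)
    (h : ∀ i j, inner ℂ (f i) (f j) = inner ℂ (g i) (g j)) :
    ∃ U : X ≃ₗᵢ[ℂ] Y, ∀ i, U (f i) = g i := by
  refine ⟨(LinearEquiv.refl ℂ (ι →₀ ℂ)).extendOfIsometry (Finsupp.linearCombination ℂ f)
    (Finsupp.linearCombination ℂ g) (denseRange_linearCombination hf)
    (denseRange_linearCombination hg) (norm_linearCombination_eq f g h), fun i => ?_⟩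
  have := LinearEquiv.extendOfIsometry_eq (LinearEquiv.refl ℂ (ι →₀ ℂ))
    (Finsupp.linearCombination ℂ f) (Finsupp.linearCombination ℂ g)
    (denseRange_linearCombination hf) (denseRange_linearCombination hg)
    (norm_linearCombination_eq f g h) (Finsupp.single i 1)
  simpa using this

theorem clm_ext_of_total {f : ι → X} (hf : (Submodule.span ℂ (Set.range f)).topologicalClosure = ⊤)
    {A B : X →L[ℂ] Y} (h : ∀ i, A (f i) = B (f i)) : A = B :=
  ContinuousLinearMap.ext_on (Submodule.dense_iff_topologicalClosure_eq_top.mpr hf)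
    (by rintro _ ⟨i, rfl⟩; exact h i)

theorem eq_of_inner_total {f : ι → X}
    (hf : (Submodule.span ℂ (Set.range f)).topologicalClosure = ⊤)
    {x y : X} (h : ∀ i, inner ℂ (f i) x = inner ℂ (f i) y) : x = y := by
  have : innerSL ℂ x = innerSL ℂ y := clm_ext_of_total hf fun i => by
    rw [innerSL_apply_apply, innerSL_apply_apply, ← inner_conj_symm, h, inner_conj_symm]
  exact ext_inner_right ℂ fun v => by simpa using congrArg (· v) this

theorem eq_top_of_total_mem {f : ι → X}
    (hf : (Submodule.span ℂ (Set.range f)).topologicalClosure = ⊤)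
    {M : Submodule ℂ X} (hM : IsClosed (M : Set X)) (h : ∀ i, f i ∈ M) : M = ⊤ := by
  rw [eq_top_iff, ← hf]
  exact Submodule.topologicalClosure_minimal _
    (Submodule.span_le.mpr (by rintro _ ⟨i, rfl⟩; exact h i)) hM

theorem total_of_orthogonal [CompleteSpace X] {f : ι → X}
    (h : ∀ x, (∀ i, inner ℂ (f i) x = 0) → x = 0) :
    (Submodule.span ℂ (Set.range f)).topologicalClosure = ⊤ := by
  rw [Submodule.topologicalClosure_eq_top_iff, eq_bot_iff]
  intro x hx
  exact h x fun i => hx _ (Submodule.subset_span ⟨i, rfl⟩)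

end Gram

/-! ### Positivity of the level one form -/

section Positivity

variable {H : Type*} [NormedAddCommGroup H] [InnerProductSpace ℂ H]

/-- The Bram-Halmos form of level one of a family `V`, in the semi-inner product `⟪B x, y⟫`. -/
def levelForm {Ω : Type*} [Fintype Ω] (B : H →L[ℂ] H) (V : Ω → H →L[ℂ] H) (x : Ω → H) : ℂ :=
  ∑ σ, ∑ ω, inner ℂ (B (V ω (x σ))) (V σ (x ω))

variable {Ω : Type*} [Fintype Ω] {B : H →L[ℂ] H} {V : Ω → H →L[ℂ] H}

/-- For natural M the form is the sum of ⟨Bz, z⟩ over all words σ of length M, where z =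
V_{σ_1}⋯V_{σ_M} y + Σ_j (∏_{l≠j} V_{σ_l}) x_{σ_j}. By commutativity and `hiso` the M diagonal pairs
(j, j) each contribute Σ_ω ⟨B x_ω, x_ω⟩ and the M(M−1) others each contribute `levelForm`. Splitting
one letter σ off a word of length M + 1 replaces y by V_σ y + x_σ and x by V_σ x. -/
theorem exchangeable_step (hV : ∀ σ ω, Commute (V σ) (V ω))
    (hiso : ∀ x y, ∑ σ, inner ℂ (B (V σ x)) (V σ y) = inner ℂ (B x) y)
    (M : ℂ) (y : H) (x : Ω → H) :
    ∑ σ, (inner ℂ (B (V σ y + x σ)) (V σ y + x σ) +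
        M * ∑ ω, (inner ℂ (B (V ω (V σ y + x σ))) (V σ (x ω)) +
          inner ℂ (B (V σ (x ω))) (V ω (V σ y + x σ))) +
        M * (M - 1) * levelForm B V (fun ω => V σ (x ω)) +
        M * ∑ ω, inner ℂ (B (V σ (x ω))) (V σ (x ω))) =
      inner ℂ (B y) y +
        (M + 1) * ∑ ω, (inner ℂ (B (V ω y)) (x ω) + inner ℂ (B (x ω)) (V ω y)) +
        (M + 1) * (M + 1 - 1) * levelForm B V x +
        (M + 1) * ∑ ω, inner ℂ (B (x ω)) (x ω) := by
  have hc : ∀ σ ω z, V σ (V ω z) = V ω (V σ z) := fun σ ω z =>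
    congrArg (fun A : H →L[ℂ] H => A z) (hV σ ω).eq
  have h1 : ∑ σ, ∑ ω, inner ℂ (B (V ω (V σ y))) (V σ (x ω)) =
      ∑ ω, inner ℂ (B (V ω y)) (x ω) := by
    rw [Finset.sum_comm]
    refine Finset.sum_congr rfl fun ω _ => ?_
    simp_rw [hc ω]
    exact hiso _ _
  have h2 : ∑ σ, ∑ ω, inner ℂ (B (V σ (x ω))) (V ω (V σ y)) =
      ∑ ω, inner ℂ (B (x ω)) (V ω y) := by
    rw [Finset.sum_comm]
    refine Finset.sum_congr rfl fun ω _ => ?_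
    simp_rw [hc ω]
    exact hiso _ _
  have h3 : ∑ σ, levelForm B V (fun ω => V σ (x ω)) = levelForm B V x := by
    unfold levelForm
    rw [Finset.sum_comm]
    refine Finset.sum_congr rfl fun τ _ => ?_
    rw [Finset.sum_comm]
    refine Finset.sum_congr rfl fun ω _ => ?_
    simp_rw [hc ω, hc τ]
    exact hiso _ _
  have h4 : ∑ σ, ∑ ω, inner ℂ (B (V σ (x ω))) (V σ (x ω)) = ∑ ω, inner ℂ (B (x ω)) (x ω) := by
    rw [Finset.sum_comm]
    exact Finset.sum_congr rfl fun ω _ => hiso _ _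
  have h5 : ∑ σ, ∑ ω, inner ℂ (B (V ω (x σ))) (V σ (x ω)) = levelForm B V x := rfl
  have h6 : ∑ σ, ∑ ω, inner ℂ (B (V σ (x ω))) (V ω (x σ)) = levelForm B V x := Finset.sum_comm
  simp only [map_add, inner_add_left, inner_add_right, Finset.sum_add_distrib, mul_add,
    ← Finset.mul_sum, h1, h2, h3, h4, h5, h6, hiso]
  ring

theorem exchangeable_nonneg (hB : ∀ x, 0 ≤ (inner ℂ (B x) x).re)
    (hV : ∀ σ ω, Commute (V σ) (V ω))
    (hiso : ∀ x y, ∑ σ, inner ℂ (B (V σ x)) (V σ y) = inner ℂ (B x) y) (M : ℕ) :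
    ∀ (y : H) (x : Ω → H), 0 ≤ (inner ℂ (B y) y +
        M * ∑ ω, (inner ℂ (B (V ω y)) (x ω) + inner ℂ (B (x ω)) (V ω y)) +
        M * (M - 1) * levelForm B V x + M * ∑ ω, inner ℂ (B (x ω)) (x ω)).re := by
  induction M with
  | zero => intro y x; simpa using hB y
  | succ M ih =>
    intro y x
    push_cast
    rw [← exchangeable_step hV hiso, Complex.re_sum]
    exact Finset.sum_nonneg fun σ _ => ih _ _

/-- Positivity of the level one form of a commuting family that is a spherical isometry for the
semi-inner product `⟪B x, y⟫`. -/
theorem levelForm_re_nonneg (hB : ∀ x, 0 ≤ (inner ℂ (B x) x).re)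
    (hV : ∀ σ ω, Commute (V σ) (V ω))
    (hiso : ∀ x y, ∑ σ, inner ℂ (B (V σ x)) (V σ y) = inner ℂ (B x) y) (x : Ω → H) :
    0 ≤ (levelForm B V x).re := by
  by_contra! hneg
  set q := (levelForm B V x).re
  set c := (∑ ω, inner ℂ (B (x ω)) (x ω)).re
  -- At y = 0, with M + 1 letters, the nonnegative form is (M + 1)(M q + c), which is negative for M
  -- > c/(−q) if q < 0.
  obtain ⟨M, hM⟩ := exists_nat_gt (c / -q)
  have h := exchangeable_nonneg hB hV hiso (M + 1) 0 x
  have h' : 0 ≤ ((M : ℝ) + 1) * M * q + (M + 1) * c := by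
    have e : (inner ℂ (B 0) 0 +
        ((M + 1 : ℕ) : ℂ) * ∑ ω, (inner ℂ (B (V ω 0)) (x ω) + inner ℂ (B (x ω)) (V ω 0)) +
        ((M + 1 : ℕ) : ℂ) * (((M + 1 : ℕ) : ℂ) - 1) * levelForm B V x +
        ((M + 1 : ℕ) : ℂ) * ∑ ω, inner ℂ (B (x ω)) (x ω)) =
        (((M + 1) * M : ℝ) : ℂ) * levelForm B V x +
        (((M + 1 : ℝ)) : ℂ) * ∑ ω, inner ℂ (B (x ω)) (x ω) := by
      simp
    rwa [e, Complex.add_re, Complex.re_ofReal_mul, Complex.re_ofReal_mul] at h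
  rw [div_lt_iff₀ (by linarith)] at hM
  have : (0 : ℝ) < M + 1 := by positivity
  nlinarith

end Positivity

theorem clm_mul_apply {E : Type*} [NormedAddCommGroup E] [InnerProductSpace ℂ E]
    (A B : E →L[ℂ] E) (x : E) : (A * B) x = A (B x) := rfl

theorem clm_one_apply {E : Type*} [NormedAddCommGroup E] [InnerProductSpace ℂ E] (x : E) :
    (1 : E →L[ℂ] E) x = x := rfl

/-! ### Words, kernel positivity and the spherical unitary extension -/

section Words

variable {d : ℕ} {H : Type u} [NormedAddCommGroup H] [InnerProductSpace ℂ H]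

/-- The product of the operators of a tuple along a word. -/
def wordOp (V : Fin d → H →L[ℂ] H) (w : List (Fin d)) : H →L[ℂ] H := (w.map V).prod

@[simp] theorem wordOp_nil (V : Fin d → H →L[ℂ] H) : wordOp V [] = 1 := rfl

@[simp] theorem wordOp_cons (V : Fin d → H →L[ℂ] H) (i : Fin d) (w : List (Fin d)) :
    wordOp V (i :: w) = V i * wordOp V w := by simp [wordOp]

theorem commute_wordOp {V : Fin d → H →L[ℂ] H} {A : H →L[ℂ] H}
    (hA : ∀ i, Commute A (V i)) (w : List (Fin d)) : Commute A (wordOp V w) := by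
  induction w with
  | nil => exact Commute.one_right _
  | cons i w ih => rw [wordOp_cons]; exact (hA i).mul_right ih

theorem commute_wordOp_wordOp {V : Fin d → H →L[ℂ] H} (hV : ∀ i j, Commute (V i) (V j))
    (v w : List (Fin d)) : Commute (wordOp V v) (wordOp V w) :=
  commute_wordOp (fun i => (commute_wordOp (fun j => hV i j) v).symm) w

/-- The finite set of words of length at most `L`. -/
def wordsLE (d : ℕ) : ℕ → Finset (List (Fin d))
  | 0 => {[]}
  | L + 1 => insert [] ((Finset.univ ×ˢ wordsLE d L).image fun p => p.1 :: p.2)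

theorem mem_wordsLE {L : ℕ} {w : List (Fin d)} (h : w.length ≤ L) : w ∈ wordsLE d L := by
  induction L generalizing w with
  | zero => simp [wordsLE, List.length_eq_zero_iff.mp (Nat.le_zero.mp h)]
  | succ L ih =>
    cases w with
    | nil => simp [wordsLE]
    | cons i w => simpa [wordsLE] using ih (by simpa using h)

/-- Each of the L + 1 word lengths contributes ⟨Bx, y⟩ once. Hence all words of length at most L,
scaled by (L + 1)^(−1/2), again form a commuting spherical isometry. -/
theorem sum_wordsLE {B : H →L[ℂ] H} {V : Fin d → H →L[ℂ] H}
    (hiso : ∀ x y, ∑ i, inner ℂ (B (V i x)) (V i y) = inner ℂ (B x) y) (L : ℕ) (x y : H) :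
    ∑ w ∈ wordsLE d L, inner ℂ (B (wordOp V w x)) (wordOp V w y) = (L + 1) * inner ℂ (B x) y := by
  induction L with
  | zero => simp [wordsLE]
  | succ L ih =>
    rw [wordsLE, Finset.sum_insert (by simp), Finset.sum_image (by simp),
      Finset.sum_product_right]
    simp only [wordOp_cons, clm_mul_apply, hiso, ih, wordOp_nil,
      clm_one_apply]
    push_cast
    ring

variable {B : H →L[ℂ] H} {V : Fin d → H →L[ℂ] H}

/-- Positivity at every level reduces to level one: this is, up to the factor L + 1, the level one
form of the family of scaled words of length at most L, where L bounds the words in the support of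
x. -/
theorem wordForm_re_nonneg (hB : ∀ x, 0 ≤ (inner ℂ (B x) x).re)
    (hV : ∀ i j, Commute (V i) (V j))
    (hiso : ∀ x y, ∑ i, inner ℂ (B (V i x)) (V i y) = inner ℂ (B x) y)
    (x : List (Fin d) →₀ H) :
    0 ≤ (x.sum fun v h => x.sum fun w k => inner ℂ (B (wordOp V w h)) (wordOp V v k)).re := by
  set L := x.support.sup List.length
  have hsub : x.support ⊆ wordsLE d L := fun w hw => mem_wordsLE (Finset.le_sup hw)
  have hL : (0 : ℝ) < L + 1 := by positivity
  set r : ℝ := (√(L + 1))⁻¹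
  have hr : (r : ℂ) * r = ((L : ℂ) + 1)⁻¹ := by
    rw [← Complex.ofReal_mul, ← mul_inv, Real.mul_self_sqrt hL.le]
    push_cast
    rfl
  let W : wordsLE d L → H →L[ℂ] H := fun w => (r : ℂ) • wordOp V w
  have hW : 0 ≤ (levelForm B W fun w => x w).re := by
    refine levelForm_re_nonneg hB (fun v w => ?_) (fun y z => ?_) _
    · exact ((commute_wordOp_wordOp hV _ _).smul_left _).smul_right _
    · simp only [W, smul_apply, map_smul, inner_smul_left, inner_smul_right,
        Complex.conj_ofReal, ← mul_assoc, hr, ← Finset.mul_sum]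
      rw [Finset.sum_coe_sort (wordsLE d L)
        (fun w => inner ℂ (B (wordOp V w y)) (wordOp V w z)), sum_wordsLE hiso, ← mul_assoc,
        inv_mul_cancel₀ (by exact_mod_cast hL.ne'), one_mul]
  have e : (levelForm B W fun w => x w) = ((((L : ℝ) + 1)⁻¹ : ℝ) : ℂ) *
      (x.sum fun v h => x.sum fun w k => inner ℂ (B (wordOp V w h)) (wordOp V v k)) := by
    simp only [levelForm, W, smul_apply, map_smul, inner_smul_left,
      inner_smul_right, Complex.conj_ofReal, ← mul_assoc, hr, ← Finset.mul_sum]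
    push_cast
    congr 1
    rw [Finsupp.sum_of_support_subset x hsub _ (by simp [Finsupp.sum]),
      Finset.sum_coe_sort (wordsLE d L) (fun v => ∑ w : wordsLE d L,
        inner ℂ (B (wordOp V w (x v))) (wordOp V v (x w)))]
    refine Finset.sum_congr rfl fun v _ => ?_
    rw [Finsupp.sum_of_support_subset x hsub _ (by simp),
      Finset.sum_coe_sort (wordsLE d L) (fun w =>
        inner ℂ (B (wordOp V w (x v))) (wordOp V v (x w)))]
  rw [e, Complex.re_ofReal_mul] at hW
  exact nonneg_of_mul_nonneg_right hW (by positivity)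

variable [CompleteSpace H]

/-- The operator-valued kernel on words whose reproducing kernel Hilbert space carries the minimal
normal extension of a spherical isometry. -/
def wordKernel (B : H →L[ℂ] H) (V : Fin d → H →L[ℂ] H) :
    Matrix (List (Fin d)) (List (Fin d)) (H →L[ℂ] H) :=
  Matrix.of fun v w => star (wordOp V w) * B * wordOp V v

theorem inner_wordKernel (v w : List (Fin d)) (x y : H) :
    inner ℂ (wordKernel B V v w x) y = inner ℂ (B (wordOp V v x)) (wordOp V w y) := by
  simp [wordKernel, ContinuousLinearMap.star_eq_adjoint, ContinuousLinearMap.adjoint_inner_left]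

theorem posSemidef_wordKernel (hB : B.IsPositive) (hV : ∀ i j, Commute (V i) (V j))
    (hiso : ∀ x y, ∑ i, inner ℂ (B (V i x)) (V i y) = inner ℂ (B x) y) :
    (wordKernel B V).PosSemidef := by
  refine ((RKHS.posSemidef_tfae (K := wordKernel B V)).out 0 2).mpr (And.intro ?_ fun x => ?_)
  · ext1 v w
    simp [wordKernel, Matrix.conjTranspose_apply, hB.isSelfAdjoint.star_eq, mul_assoc]
  · simp only [inner_wordKernel]
    exact wordForm_re_nonneg hB.re_inner_nonneg_left hV hiso x

/-- In the extension built from it, k_w becomes Z_w R. Moving commuting normal operators across ⟨Z_v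
R x, Z_w R y⟩ gives ⟨Z_w^* R x, Z_v^* R y⟩, which is why the words cross on the right. -/
theorem exists_kernel_functions (hB : B.IsPositive) (hV : ∀ i j, Commute (V i) (V j))
    (hiso : ∀ x y, ∑ i, inner ℂ (B (V i x)) (V i y) = inner ℂ (B x) y) :
    ∃ (E : Type u) (_ : NormedAddCommGroup E) (_ : InnerProductSpace ℂ E)
      (_ : CompleteSpace E) (k : List (Fin d) → H →L[ℂ] E),
      (∀ v w x y, inner ℂ (k v x) (k w y) = inner ℂ (B (wordOp V w x)) (wordOp V v y)) ∧
      (Submodule.span ℂ (Set.range fun p : List (Fin d) × H => k p.1 p.2)).topologicalClosure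
        = ⊤ := by
  have : Fact (wordKernel B V).PosSemidef := ⟨posSemidef_wordKernel hB hV hiso⟩
  refine ⟨RKHS.OfKernel (wordKernel B V), inferInstance, inferInstance, inferInstance,
    fun w => RKHS.kerFun _ w, fun v w x y => ?_, ?_⟩
  · rw [← inner_wordKernel, ← RKHS.kernel_inner, RKHS.OfKernel.kernel_ofKernel]
  · rw [← RKHS.kerFun_dense]
    congr 2
    ext y
    simp

/-- A commuting family that is a spherical isometry for the semi-inner product `⟪B x, y⟫` extends
to (the adjoint of) a spherical unitary. -/
theorem exists_sphericalUnitary_extension (hB : B.IsPositive) (hV : ∀ i j, Commute (V i) (V j))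
    (hiso : ∀ x y, ∑ i, inner ℂ (B (V i x)) (V i y) = inner ℂ (B x) y) :
    ∃ (HZ : Type u) (_ : NormedAddCommGroup HZ) (_ : InnerProductSpace ℂ HZ)
      (_ : CompleteSpace HZ) (Z : Fin d → HZ →L[ℂ] HZ) (R : H →L[ℂ] HZ),
      IsSphericalUnitary Z ∧ (∀ x y, inner ℂ (R x) (R y) = inner ℂ (B x) y) ∧
      (∀ i x, star (Z i) (R x) = R (V i x)) ∧
      (Submodule.span ℂ (Set.range fun p : List (Fin d) × H =>
        wordOp Z p.1 (R p.2))).topologicalClosure = ⊤ := by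
  obtain ⟨E, _, _, _, k, hk, hf⟩ := exists_kernel_functions hB hV hiso
  let f : List (Fin d) × H → E := fun p => k p.1 p.2
  replace hf : (Submodule.span ℂ (Set.range f)).topologicalClosure = ⊤ := hf
  -- The isometry k_v x ↦ (k_v V_i x)_i yields the boundedness of all its components N_i and Σ N_i^*
  -- N_i = I at once.
  have hgram : ∀ p q : List (Fin d) × H, inner ℂ (f p) (f q) =
      inner ℂ (WithLp.toLp 2 fun i => k p.1 (V i p.2) : PiLp 2 fun _ : Fin d => E)
        (WithLp.toLp 2 fun i => k q.1 (V i q.2)) := by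
    rintro ⟨v, x⟩ ⟨w, y⟩
    have hc : ∀ i u z, wordOp V u (V i z) = V i (wordOp V u z) := fun i u z =>
      (congrArg (fun A : H →L[ℂ] H => A z) (commute_wordOp (fun j => hV i j) u).eq).symm
    simp only [PiLp.inner_apply, f, hk, hc, hiso]
  obtain ⟨C, hC⟩ := exists_linearIsometry_of_inner_eq f _ hf hgram
  let N : Fin d → E →L[ℂ] E := fun i =>
    (PiLp.proj 2 (fun _ : Fin d => E) i) ∘L C.toContinuousLinearMap
  have hN : ∀ i w x, N i (k w x) = k w (V i x) := fun i w x => by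
    have := congrArg (fun z : PiLp 2 (fun _ : Fin d => E) => z i) (hC (w, x))
    simpa [N, f] using this
  have hNs : ∀ i w x, star (N i) (k w x) = k (i :: w) x := fun i w x => by
    refine eq_of_inner_total hf fun ⟨v, y⟩ => ?_
    rw [ContinuousLinearMap.star_eq_adjoint, ContinuousLinearMap.adjoint_inner_right]
    simp only [f, hN, hk, wordOp_cons, (commute_wordOp (fun j => hV i j) w).eq]
    rfl
  have hNc : ∀ i j, Commute (N i) (N j) := fun i j => by
    refine clm_ext_of_total hf fun ⟨w, x⟩ => ?_
    have : V i (V j x) = V j (V i x) := congrArg (fun A : H →L[ℂ] H => A x) (hV i j).eq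
    simp [f, hN, this]
  refine ⟨E, inferInstance, inferInstance, inferInstance, fun i => star (N i), k [],
    ⟨fun i j => (hNc i j).star_star, fun i => ?_, ?_⟩, fun x y => by simp [hk],
    fun i x => by rw [star_star, hN], ?_⟩
  · refine ⟨?_⟩
    -- N_i acts on the vector and N_i^* on the word, so both products send k_w x to k_{iw} (V_i x).
    refine clm_ext_of_total hf fun ⟨w, x⟩ => ?_
    simp [f, hN, hNs]
  · refine clm_ext_of_total hf fun p => ext_inner_left ℂ fun z => ?_
    have := C.inner_map_map z (f p)
    rw [PiLp.inner_apply] at this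
    simp only [star_star, sum_apply, inner_sum,
      clm_one_apply, clm_mul_apply]
    rw [← this]
    refine Finset.sum_congr rfl fun i _ => ?_
    rw [ContinuousLinearMap.star_eq_adjoint, ContinuousLinearMap.adjoint_inner_right]
    rfl
  · have : (fun p : List (Fin d) × H => wordOp (fun i => star (N i)) p.1 (k [] p.2)) = f := by
      ext1 ⟨w, x⟩
      change wordOp (fun i => star (N i)) w (k [] x) = k w x
      induction w with
      | nil => rfl
      | cons i w ih => rw [wordOp_cons, clm_mul_apply, ih, hNs]
    rw [this, hf]

end Words

/-! ### The d-shift and its adjoint on monomials -/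

section Monomials

variable {d : ℕ}

/-- The monomial `z ^ α` as a polynomial. -/
def polyMono (α : Fin d →₀ ℕ) : Poly d := (MvPolynomial.monomial α 1 : MvPolynomial (Fin d) ℂ)

/-- The monomial `z ^ α` as an element of `H²_d`. -/
def mono (α : Fin d →₀ ℕ) : H2 d := (polyMono α : Poly d)

theorem inner_mono [DecidableEq (Fin d →₀ ℕ)] (α β : Fin d →₀ ℕ) :
    inner ℂ (mono α) (mono β) = if α = β then (weight α : ℂ) else 0 := by
  unfold mono
  rw [UniformSpace.Completion.inner_coe]
  change polyInner _ _ = _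
  rw [polyInner_eq_sum (polyMono α) (polyMono β) {α} (Or.inl MvPolynomial.support_monomial_subset),
    Finset.sum_singleton]
  have h1 : (polyMono α).coeff α = 1 := by
    simp [polyMono, Poly.coeff]
  have h2 : (polyMono β).coeff α = if α = β then 1 else 0 := by
    simp [polyMono, Poly.coeff, MvPolynomial.coeff_monomial, eq_comm]
  rw [h1, h2]
  split_ifs <;> simp

theorem shift_mono (i : Fin d) (α : Fin d →₀ ℕ) :
    shift d i (mono α) = mono (α + Finsupp.single i 1) := by
  unfold mono shift
  rw [ContinuousLinearMap.completion_apply_coe]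
  congr 1
  change (MvPolynomial.X i * MvPolynomial.monomial α 1 : MvPolynomial (Fin d) ℂ) =
    MvPolynomial.monomial _ 1
  rw [MvPolynomial.X, MvPolynomial.monomial_mul, add_comm, one_mul]

theorem mono_total :
    (Submodule.span ℂ (Set.range (mono : (Fin d →₀ ℕ) → H2 d))).topologicalClosure = ⊤ := by
  rw [← Submodule.dense_iff_topologicalClosure_eq_top]
  refine Dense.mono ?_ (UniformSpace.Completion.denseRange_coe (α := Poly d))
  rintro _ ⟨p, rfl⟩
  have hp : p = ∑ α ∈ p.support, p.coeff α • polyMono α := by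
    have := MvPolynomial.as_sum (show MvPolynomial (Fin d) ℂ from p)
    refine this.trans (Finset.sum_congr rfl fun α _ => ?_)
    change _ = (MvPolynomial.coeff α p) • (MvPolynomial.monomial α 1 : MvPolynomial (Fin d) ℂ)
    rw [MvPolynomial.smul_monomial, smul_eq_mul, mul_one]
  rw [hp, ← UniformSpace.Completion.coe_toComplL (𝕜 := ℂ), map_sum]
  refine Submodule.sum_mem _ fun α _ => ?_
  rw [map_smul]
  exact Submodule.smul_mem _ _ (Submodule.subset_span ⟨α, rfl⟩)

/-- The degree `|α|` of a multi-index. -/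
def deg (α : Fin d →₀ ℕ) : ℕ := ∑ i, α i

@[simp] theorem deg_zero : deg (0 : Fin d →₀ ℕ) = 0 := by simp [deg]

@[simp] theorem deg_add_single (α : Fin d →₀ ℕ) (i : Fin d) :
    deg (α + Finsupp.single i 1) = deg α + 1 := by
  simp [deg, Finset.sum_add_distrib, Finsupp.single_apply]

theorem deg_eq_zero {α : Fin d →₀ ℕ} : deg α = 0 ↔ α = 0 := by
  simp [deg, Finset.sum_eq_zero_iff, Finsupp.ext_iff]

theorem weight_zero : weight (0 : Fin d →₀ ℕ) = 1 := by simp [weight]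

theorem weight_add_single (α : Fin d →₀ ℕ) (i : Fin d) :
    ((deg α : ℝ) + 1) * weight (α + Finsupp.single i 1) = (α i + 1) * weight α := by
  classical
  have h1 : ∏ j, ((α + Finsupp.single i 1 : Fin d →₀ ℕ) j).factorial =
      (α i + 1) * ∏ j, (α j).factorial := by
    rw [← Finset.mul_prod_erase _ _ (Finset.mem_univ i),
      ← Finset.mul_prod_erase _ (fun j => (α j).factorial) (Finset.mem_univ i), ← mul_assoc]
    congr 1
    · simp [Nat.factorial_succ]
    · refine Finset.prod_congr rfl fun j hj => ?_
      have : i ≠ j := (Finset.ne_of_mem_erase hj).symm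
      simp [this]
  have h2 : ∑ j, (α + Finsupp.single i 1 : Fin d →₀ ℕ) j = deg α + 1 := deg_add_single α i
  have h3 : (0 : ℝ) < ((deg α).factorial : ℝ) := by exact_mod_cast Nat.factorial_pos _
  unfold weight
  rw [h1, h2, Nat.factorial_succ]
  change _ = _ * (_ / ((deg α).factorial : ℝ))
  push_cast
  field_simp

theorem sub_single_add_single {α : Fin d →₀ ℕ} {i : Fin d} (h : α i ≠ 0) :
    α - Finsupp.single i 1 + Finsupp.single i 1 = α :=
  tsub_add_cancel_of_le (by simpa [Nat.one_le_iff_ne_zero] using h)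

theorem deg_sub_single {α : Fin d →₀ ℕ} {i : Fin d} (h : α i ≠ 0) :
    deg (α - Finsupp.single i 1) + 1 = deg α := by
  rw [← deg_add_single, sub_single_add_single h]

theorem deg_mul_weight {α : Fin d →₀ ℕ} {i : Fin d} (h : α i ≠ 0) :
    (deg α : ℝ) * weight α = α i * weight (α - Finsupp.single i 1) := by
  have h1 := weight_add_single (α - Finsupp.single i 1) i
  rw [sub_single_add_single h] at h1
  have h2 : (((α - Finsupp.single i 1 : Fin d →₀ ℕ) i : ℕ) : ℝ) + 1 = α i := by
    have : (α - Finsupp.single i 1 : Fin d →₀ ℕ) i + 1 = α i := by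
      simp; omega
    exact_mod_cast this
  have h3 : (deg (α - Finsupp.single i 1) : ℝ) + 1 = deg α := by
    exact_mod_cast deg_sub_single h
  rwa [h2, h3] at h1

/-- If β i = 0, truncated subtraction leaves β unchanged, but then the coefficient vanishes; for β =
0 it is 0/0 = 0. -/
theorem star_shift_mono (i : Fin d) (β : Fin d →₀ ℕ) :
    star (shift d i) (mono β) =
      ((β i : ℂ) / (deg β : ℂ)) • mono (β - Finsupp.single i 1) := by
  classical
  refine eq_of_inner_total mono_total fun α => ?_
  rw [ContinuousLinearMap.star_eq_adjoint, ContinuousLinearMap.adjoint_inner_right, shift_mono,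
    inner_smul_right, inner_mono, inner_mono]
  by_cases h : β i = 0
  · have : α + Finsupp.single i 1 ≠ β := fun e => by
      have := congrArg (fun γ : Fin d →₀ ℕ => γ i) e
      simp [h] at this
    simp [h, this]
  · have hiff : α + Finsupp.single i 1 = β ↔ α = β - Finsupp.single i 1 := by
      constructor
      · rintro rfl; simp
      · rintro rfl; exact sub_single_add_single h
    have hdeg : (deg β : ℂ) ≠ 0 := by
      have := deg_sub_single h
      exact_mod_cast (by omega : deg β ≠ 0)
    by_cases e : α = β - Finsupp.single i 1
    · rw [if_pos (hiff.mpr e), if_pos e, hiff.mpr e, e]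
      have h4 : (deg β : ℂ) * (weight β : ℂ) = β i * (weight (β - Finsupp.single i 1) : ℂ) := by
        exact_mod_cast deg_mul_weight h
      field_simp
      rw [mul_comm, h4]
    · rw [if_neg (mt hiff.mp e), if_neg e, mul_zero]

theorem sum_div_deg {β : Fin d →₀ ℕ} (h : β ≠ 0) : ∑ i, (β i : ℂ) / (deg β : ℂ) = 1 := by
  have hd : (deg β : ℂ) ≠ 0 := by exact_mod_cast mt deg_eq_zero.mp h
  rw [← Finset.sum_div, ← Nat.cast_sum]
  exact div_self hd

/-- The monomials diagonalize all S_i S_i^* simultaneously. By `sum_div_deg` the eigenvalues add up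
to 1 away from the constants, which identifies the defect of S. -/
theorem shift_star_shift_mono (i : Fin d) (β : Fin d →₀ ℕ) :
    shift d i (star (shift d i) (mono β)) = ((β i : ℂ) / (deg β : ℂ)) • mono β := by
  rw [star_shift_mono, map_smul, shift_mono]
  by_cases h : β i = 0
  · simp [h]
  · rw [sub_single_add_single h]

end Monomials

/-! ### Elementary tensors in n·E = ℓ²(n) ⊗ E -/

section Tensor

variable {E : Type u} [NormedAddCommGroup E] [InnerProductSpace ℂ E] {n : ℕ∞}

theorem memLp_smul (f : E) (c : Copies n ℂ) :
    Memℓp (fun k : Idx n => c k • f) 2 := by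
  refine ((lp.memℓp c).norm.const_mul ‖f‖).mono' fun k => ?_
  simp [norm_smul, mul_comm]

/-- The elementary tensors `c ⊗ f` in `n · E = ℓ²(n) ⊗ E`. -/
def tens (f : E) : Copies n ℂ →L[ℂ] Copies n E :=
  LinearMap.mkContinuous
    { toFun := fun c => ⟨fun k => c k • f, memLp_smul f c⟩
      map_add' := fun x y => by ext k; exact add_smul (x k) (y k) f
      map_smul' := fun a x => by ext k; exact mul_smul a (x k) f } ‖f‖ fun c => by
    refine (lp.norm_mono (p := 2) (by norm_num) (y := (‖f‖ : ℂ) • c) fun k => ?_).trans ?_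
    · rw [lp.coeFn_smul, Pi.smul_apply, norm_smul, Complex.norm_real, norm_norm, mul_comm]
      exact (norm_smul _ _).le
    · simpa using lp.norm_const_smul_le (p := 2) (by norm_num) (‖f‖ : ℂ) c

@[simp] theorem tens_apply (f : E) (c : Copies n ℂ) (k : Idx n) : tens f c k = c k • f := rfl

@[simp] theorem ampliation_apply (A : E →L[ℂ] E) (x : Copies n E) (k : Idx n) :
    ampliation n A x k = A (x k) := rfl

theorem ampliation_tens (A : E →L[ℂ] E) (f : E) (c : Copies n ℂ) :
    ampliation n A (tens f c) = tens (A f) c := by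
  ext k
  simp

theorem tens_smul (a : ℂ) (f : E) (c : Copies n ℂ) : tens (a • f) c = a • tens f c := by
  ext k
  exact smul_comm (c k) a f

theorem inner_tens_tens (f g : E) (b c : Copies n ℂ) :
    inner ℂ (tens f b) (tens g c) = inner ℂ f g * inner ℂ b c := by
  rw [lp.inner_eq_tsum, lp.inner_eq_tsum, ← tsum_mul_left]
  refine tsum_congr fun k => ?_
  simp only [tens_apply, inner_smul_left, inner_smul_right, RCLike.inner_apply]
  ring

theorem inner_tens_single (f : E) (k : Idx n) (x : Copies n E) :
    inner ℂ (tens f (lp.single 2 k 1)) x = inner ℂ f (x k) := by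
  have : (tens f (lp.single 2 k (1 : ℂ)) : Copies n E) = lp.single 2 k f := by
    ext j
    rw [tens_apply, lp.single_apply, lp.single_apply]
    by_cases h : j = k
    · subst h; simp
    · simp [h]
  rw [this, lp.inner_single_left]

variable [CompleteSpace E]

theorem tens_total {ι : Type*} {f : ι → E}
    (hf : (Submodule.span ℂ (Set.range f)).topologicalClosure = ⊤) :
    (Submodule.span ℂ (Set.range fun p : ι × Copies n ℂ =>
      (tens (f p.1) p.2 : Copies n E))).topologicalClosure = ⊤ := by
  refine total_of_orthogonal fun x hx => ?_
  ext k
  refine eq_of_inner_total hf fun i => ?_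
  rw [← inner_tens_single, hx (i, _)]
  simp

theorem star_ampliation (A : E →L[ℂ] E) : star (ampliation n A) = ampliation n (star A) := by
  rw [ContinuousLinearMap.star_eq_adjoint, eq_comm, ContinuousLinearMap.eq_adjoint_iff]
  intro x y
  rw [lp.inner_eq_tsum, lp.inner_eq_tsum]
  refine tsum_congr fun k => ?_
  rw [ampliation_apply, ampliation_apply, ContinuousLinearMap.star_eq_adjoint,
    ContinuousLinearMap.adjoint_inner_left]

end Tensor

section Total

variable {H : Type u} [NormedAddCommGroup H] [InnerProductSpace ℂ H]

/-- The uniform bound `hA` makes the subspace of vectors with A_k x → 0 closed. -/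
theorem tendsto_zero_of_total {ι : Type*} {f : ι → H}
    (hf : (Submodule.span ℂ (Set.range f)).topologicalClosure = ⊤)
    {A : ℕ → H →L[ℂ] H} (hA : ∀ k x, ‖A k x‖ ≤ ‖x‖)
    (h : ∀ i, Tendsto (fun k => A k (f i)) atTop (𝓝 0)) (x : H) :
    Tendsto (fun k => A k x) atTop (𝓝 0) := by
  let M : Submodule ℂ H :=
    { carrier := {x | Tendsto (fun k => A k x) atTop (𝓝 0)}
      add_mem' := fun {x y} hx hy => by simpa using Filter.Tendsto.add hx hy
      zero_mem' := by simp
      smul_mem' := fun c x hx => by simpa using Filter.Tendsto.const_smul hx c }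
  have hM : IsClosed (M : Set H) := by
    refine isClosed_of_closure_subset fun x hx => ?_
    change Tendsto (fun k => A k x) atTop (𝓝 0)
    rw [Metric.tendsto_atTop]
    intro ε hε
    obtain ⟨y, hy, hxy⟩ := Metric.mem_closure_iff.mp hx (ε / 2) (by positivity)
    obtain ⟨N, hN⟩ := Metric.tendsto_atTop.mp (show Tendsto (fun k => A k y) atTop (𝓝 0) from hy)
      (ε / 2) (by positivity)
    refine ⟨N, fun k hk => ?_⟩
    have h1 := hN k hk
    rw [dist_zero_right] at h1 ⊢
    have h2 := hA k (x - y)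
    rw [dist_eq_norm] at hxy
    have h3 : A k x = A k (x - y) + A k y := by simp
    rw [h3]
    linarith [norm_add_le (A k (x - y)) (A k y)]
  have : x ∈ M := eq_top_of_total_mem hf hM h ▸ Submodule.mem_top
  exact this

end Total

/-! ### The map Θ_T and its iterates -/

section Theta

variable {d : ℕ} {H : Type u} [NormedAddCommGroup H] [InnerProductSpace ℂ H] [CompleteSpace H]

theorem Theta_apply (T : Fin d → H →L[ℂ] H) (A : H →L[ℂ] H) (x : H) :
    Theta T A x = ∑ i, T i (A (star (T i) x)) := by
  simp [Theta, sum_apply]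

theorem inner_Theta (T : Fin d → H →L[ℂ] H) (A : H →L[ℂ] H) (x y : H) :
    inner ℂ (Theta T A x) y = ∑ i, inner ℂ (A (star (T i) x)) (star (T i) y) := by
  rw [Theta_apply, sum_inner]
  refine Finset.sum_congr rfl fun i _ => ?_
  rw [ContinuousLinearMap.star_eq_adjoint, ContinuousLinearMap.adjoint_inner_right]

theorem Theta_iterate_succ (T : Fin d → H →L[ℂ] H) (k : ℕ) :
    (Theta T)^[k + 1] 1 = Theta T ((Theta T)^[k] 1) := Function.iterate_succ_apply' _ _ _

variable {T : Fin d → H →L[ℂ] H}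

theorem Theta_iterate_mem (hT : Theta T 1 ≤ 1) (k : ℕ) :
    0 ≤ (Theta T)^[k] 1 ∧ (Theta T)^[k] 1 ≤ 1 := by
  have mono : ∀ {A B : H →L[ℂ] H}, A ≤ B → Theta T A ≤ Theta T B := fun {A B} h =>
    Finset.sum_le_sum fun i _ => star_right_conjugate_le_conjugate h (T i)
  induction k with
  | zero => exact ⟨zero_le_one, le_rfl⟩
  | succ k ih =>
    rw [Theta_iterate_succ]
    refine ⟨?_, (mono ih.2).trans hT⟩
    have : Theta T 0 = 0 := by simp [Theta]
    exact this ▸ mono ih.1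

/-- This is A² ≤ A. It upgrades weak convergence Θ_T^k(I) → 0 to strong convergence. -/
theorem norm_apply_sq_le_of_le_one {A : H →L[ℂ] H} (h0 : 0 ≤ A) (h1 : A ≤ 1) (x : H) :
    ‖A x‖ ^ 2 ≤ (inner ℂ (A x) x).re := by
  have h := CStarAlgebra.pow_antitone h0 h1 (show 1 ≤ 2 by norm_num)
  have hsa : star A = A := (IsSelfAdjoint.of_nonneg h0).star_eq
  have h2 := ((ContinuousLinearMap.le_def _ _).mp h).re_inner_nonneg_left x
  have e : inner ℂ ((A ^ 2) x) x = inner ℂ (A x) (A x) := by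
    rw [pow_two, clm_mul_apply]
    conv_lhs => rw [← hsa]
    rw [ContinuousLinearMap.star_eq_adjoint, ContinuousLinearMap.adjoint_inner_left,
      ← ContinuousLinearMap.star_eq_adjoint, hsa]
  simp only [pow_one, sub_apply, inner_sub_left, e, map_sub] at h2
  rw [← inner_self_eq_norm_sq (𝕜 := ℂ)]
  simpa using h2

theorem norm_apply_le_of_le_one {A : H →L[ℂ] H} (h0 : 0 ≤ A) (h1 : A ≤ 1) (x : H) :
    ‖A x‖ ≤ ‖x‖ := by
  have h2 := norm_apply_sq_le_of_le_one h0 h1 x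
  have h3 : (inner ℂ (A x) x).re ≤ ‖A x‖ * ‖x‖ := re_inner_le_norm (𝕜 := ℂ) _ _
  by_contra! h
  nlinarith [norm_nonneg x, norm_nonneg (A x)]

end Theta

/-! ### Defect and purity of n·S -/

section ShiftCopies

variable {d : ℕ} {n : ℕ∞}

/-- The direct sum of `n` copies of the `d`-shift. -/
abbrev shiftN (d : ℕ) (n : ℕ∞) (i : Fin d) : Copies n (H2 d) →L[ℂ] Copies n (H2 d) :=
  ampliation n (shift d i)

/-- The embedding of `ℓ²(n)` into `n · H²_d` as vectors of constants. -/
def vac (d : ℕ) (n : ℕ∞) : Copies n ℂ →L[ℂ] Copies n (H2 d) := tens (mono 0)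

theorem monomials_total : (Submodule.span ℂ (Set.range
    fun p : (Fin d →₀ ℕ) × Copies n ℂ => (tens (mono p.1) p.2 : Copies n (H2 d)))).topologicalClosure
      = ⊤ := tens_total mono_total

theorem shiftN_tens (i : Fin d) (α : Fin d →₀ ℕ) (c : Copies n ℂ) :
    shiftN d n i (tens (mono α) c) = tens (mono (α + Finsupp.single i 1)) c := by
  rw [ampliation_tens, shift_mono]

theorem star_shiftN_tens (i : Fin d) (α : Fin d →₀ ℕ) (c : Copies n ℂ) :
    star (shiftN d n i) (tens (mono α) c) =
      ((α i : ℂ) / (deg α : ℂ)) • tens (mono (α - Finsupp.single i 1)) c := by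
  rw [star_ampliation, ampliation_tens, star_shift_mono, tens_smul]

theorem adjoint_vac_tens (α : Fin d →₀ ℕ) (c : Copies n ℂ) :
    ContinuousLinearMap.adjoint (vac d n) (tens (mono α) c) = if α = 0 then c else 0 := by
  classical
  refine ext_inner_left ℂ fun b => ?_
  rw [ContinuousLinearMap.adjoint_inner_right, vac, inner_tens_tens, inner_mono]
  by_cases h : α = 0
  · simp [h, weight_zero]
  · simp [h, Ne.symm h]

theorem adjoint_vac_vac (c : Copies n ℂ) : ContinuousLinearMap.adjoint (vac d n) (vac d n c) = c := by
  exact (adjoint_vac_tens 0 c).trans (if_pos rfl)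

/-- I − Σ S_i S_i^* is the projection onto the constants, as one sees on monomials. -/
theorem shift_defect (x : Copies n (H2 d)) :
    ∑ i, shiftN d n i (star (shiftN d n i) x) +
      vac d n (ContinuousLinearMap.adjoint (vac d n) x) = x := by
  have : Theta (shiftN d n) 1 + vac d n ∘L ContinuousLinearMap.adjoint (vac d n) = 1 := by
    refine clm_ext_of_total monomials_total fun ⟨α, c⟩ => ?_
    rw [add_apply, Theta_apply]
    simp only [clm_one_apply, ContinuousLinearMap.comp_apply, adjoint_vac_tens]
    simp only [star_ampliation, ampliation_tens, shift_star_shift_mono, tens_smul]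
    rw [← Finset.sum_smul]
    by_cases h : α = 0
    · simp [h, vac]
    · simp [h, sum_div_deg h]
  have h := congrArg (fun A : _ →L[ℂ] _ => A x) this
  simpa only [add_apply, Theta_apply, clm_one_apply, ContinuousLinearMap.comp_apply] using h

theorem sum_inner_star_shift (x y : Copies n (H2 d)) :
    ∑ i, inner ℂ (star (shiftN d n i) x) (star (shiftN d n i) y) +
      inner ℂ (ContinuousLinearMap.adjoint (vac d n) x) (ContinuousLinearMap.adjoint (vac d n) y) =
      inner ℂ x y := by
  conv_rhs => rw [← shift_defect x]
  rw [inner_add_left, sum_inner, ContinuousLinearMap.adjoint_inner_right]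
  congr 1
  refine Finset.sum_congr rfl fun i _ => ?_
  rw [ContinuousLinearMap.star_eq_adjoint, ContinuousLinearMap.adjoint_inner_right]

theorem Theta_shiftN_le_one : Theta (shiftN d n) 1 ≤ 1 := by
  rw [ContinuousLinearMap.le_def, ContinuousLinearMap.isPositive_iff_complex]
  intro x
  have h : inner ℂ ((1 - Theta (shiftN d n) 1) x) x =
      inner ℂ (ContinuousLinearMap.adjoint (vac d n) x) (ContinuousLinearMap.adjoint (vac d n) x) := by
    rw [sub_apply, inner_sub_left, inner_Theta, clm_one_apply, ← sum_inner_star_shift x x]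
    simp only [clm_one_apply]
    ring
  rw [h, inner_self_eq_norm_sq_to_K]
  norm_cast
  exact ⟨rfl, by positivity⟩

/-- Θ^k(I) applies k adjoint shifts first, each of which lowers the degree by one or gives zero. -/
theorem Theta_shiftN_iterate_tens (k : ℕ) (α : Fin d →₀ ℕ) (c : Copies n ℂ) (h : deg α < k) :
    (Theta (shiftN d n))^[k] 1 (tens (mono α) c) = 0 := by
  induction k generalizing α with
  | zero => omega
  | succ k ih =>
    rw [Theta_iterate_succ, Theta_apply]
    refine Finset.sum_eq_zero fun i _ => ?_
    rw [star_shiftN_tens, map_smul, map_smul]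
    by_cases hi : α i = 0
    · simp [hi]
    · have := deg_sub_single hi
      rw [ih _ (by omega), map_zero, smul_zero]

/-- The direct sum of copies of the `d`-shift is pure. -/
theorem isPure_shiftN : IsPure (shiftN d n) := fun x => by
  refine tendsto_zero_of_total monomials_total (A := fun k => (Theta (shiftN d n))^[k] 1)
    (fun k x => ?_) (fun ⟨α, c⟩ => ?_) x
  · obtain ⟨h0, h1⟩ := Theta_iterate_mem (T := shiftN d n) Theta_shiftN_le_one k
    exact norm_apply_le_of_le_one h0 h1 x
  · refine tendsto_const_nhds.congr' ?_
    filter_upwards [eventually_gt_atTop (deg α)] with k hk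
    exact (Theta_shiftN_iterate_tens k α c hk).symm

end ShiftCopies

/-! ### Reducing subspaces and fullness -/

section Full

variable {d : ℕ} {G : Type u} [NormedAddCommGroup G] [InnerProductSpace ℂ G]

theorem map_closure_span_le {ι : Type*} {f : ι → G} {A : G →L[ℂ] G}
    (h : ∀ i, A (f i) ∈ (Submodule.span ℂ (Set.range f)).topologicalClosure) {x : G}
    (hx : x ∈ (Submodule.span ℂ (Set.range f)).topologicalClosure) :
    A x ∈ (Submodule.span ℂ (Set.range f)).topologicalClosure := by
  have : (Submodule.span ℂ (Set.range f)).topologicalClosure ≤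
      (Submodule.span ℂ (Set.range f)).topologicalClosure.comap A.toLinearMap :=
    Submodule.topologicalClosure_minimal _
      (Submodule.span_le.mpr (by rintro _ ⟨i, rfl⟩; exact h i))
      ((Submodule.isClosed_topologicalClosure _).preimage A.continuous)
  exact this hx

theorem mem_orthogonal_span_range {ι : Type*} {f : ι → G} {x : G} :
    x ∈ (Submodule.span ℂ (Set.range f))ᗮ ↔ ∀ i, inner ℂ (f i) x = 0 := by
  refine ⟨fun h i => h _ (Submodule.subset_span ⟨i, rfl⟩), fun h y hy => ?_⟩
  induction hy using Submodule.span_induction with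
  | mem y hy => obtain ⟨i, rfl⟩ := hy; exact h i
  | zero => simp
  | add y z _ _ hy hz => rw [inner_add_left, hy, hz, add_zero]
  | smul c y _ hy => rw [inner_smul_left, hy, mul_zero]

variable [CompleteSpace G]

/-- `M` is a closed subspace that reduces the tuple `A`. -/
structure IsReducing (A : Fin d → G →L[ℂ] G) (M : Submodule ℂ G) : Prop where
  isClosed : IsClosed (M : Set G)
  map_mem : ∀ i, ∀ x ∈ M, A i x ∈ M
  star_mem : ∀ i, ∀ x ∈ M, star (A i) x ∈ M

theorem IsReducing.cstar_mem {A : Fin d → G →L[ℂ] G} {M : Submodule ℂ G} (hM : IsReducing A M)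
    {X : G →L[ℂ] G} (hX : X ∈ cstar A) {x : G} (hx : x ∈ M) : X x ∈ M := by
  -- Y and its adjoint are carried together so that the star case of the induction closes.
  have h1 : ∀ Y ∈ StarAlgebra.adjoin ℂ (Set.range A),
      (∀ x ∈ M, Y x ∈ M) ∧ ∀ x ∈ M, star Y x ∈ M := fun Y hY => by
    induction hY using StarAlgebra.adjoin_induction with
    | mem Y hY => obtain ⟨i, rfl⟩ := hY; exact ⟨hM.map_mem i, hM.star_mem i⟩
    | algebraMap r =>
      refine ⟨fun x hx => ?_, fun x hx => ?_⟩
      · rw [Algebra.algebraMap_eq_smul_one]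
        exact M.smul_mem _ hx
      · rw [Algebra.algebraMap_eq_smul_one, star_smul, star_one]
        exact M.smul_mem _ hx
    | add Y Y' _ _ h h' =>
      refine ⟨fun x hx => M.add_mem (h.1 x hx) (h'.1 x hx), fun x hx => ?_⟩
      rw [star_add]
      exact M.add_mem (h.2 x hx) (h'.2 x hx)
    | mul Y Y' _ _ h h' =>
      refine ⟨fun x hx => h.1 _ (h'.1 x hx), fun x hx => ?_⟩
      rw [star_mul]
      exact h'.2 _ (h.2 x hx)
    | star Y _ h =>
      refine ⟨h.2, fun x hx => ?_⟩
      rw [star_star]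
      exact h.1 x hx
  have h2 : IsClosed {Y : G →L[ℂ] G | Y x ∈ M} :=
    hM.isClosed.preimage (ContinuousLinearMap.apply ℂ G x).continuous
  exact closure_minimal (fun Y hY => (h1 Y hY).1 x hx) h2 hX

theorem mem_cstar (A : Fin d → G →L[ℂ] G) (i : Fin d) : A i ∈ cstar A :=
  StarSubalgebra.le_topologicalClosure _ (StarAlgebra.subset_adjoin ℂ _ ⟨i, rfl⟩)

/-- `K` is full if and only if no proper closed subspace containing `K` is reducing. -/
theorem isFull_iff (A : Fin d → G →L[ℂ] G) (K : ClosedSubmodule ℂ G) :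
    IsFull A K ↔ ∀ M : Submodule ℂ G, IsReducing A M → (∀ x ∈ K, x ∈ M) → M = ⊤ := by
  have hset : {y : G | ∃ X ∈ cstar A, ∃ x ∈ K, X x = y} =
      Set.range fun p : cstar A × K => (p.1 : G →L[ℂ] G) (p.2 : G) := by
    ext y
    simp
  constructor
  · intro h M hM hK
    rw [eq_top_iff, ← h]
    refine Submodule.topologicalClosure_minimal _ (Submodule.span_le.mpr ?_) hM.isClosed
    rintro _ ⟨X, hX, x, hx, rfl⟩
    exact hM.cstar_mem hX (hK x hx)
  · intro h
    -- The closed span of C*(1, A)K is itself reducing, and it contains K because the algebra is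
    -- unital.
    have key : ∀ Y ∈ cstar A, ∀ y ∈ (Submodule.span ℂ (Set.range fun p : cstar A × K =>
        (p.1 : G →L[ℂ] G) (p.2 : G))).topologicalClosure, Y y ∈
        (Submodule.span ℂ (Set.range fun p : cstar A × K =>
        (p.1 : G →L[ℂ] G) (p.2 : G))).topologicalClosure := fun Y hY y hy =>
      map_closure_span_le (fun p => Submodule.le_topologicalClosure _
        (Submodule.subset_span ⟨(⟨Y * p.1, mul_mem hY p.1.2⟩, p.2), rfl⟩)) hy
    unfold IsFull
    rw [hset]
    refine h _ ⟨Submodule.isClosed_topologicalClosure _, fun i => key _ (mem_cstar A i),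
      fun i => key _ (star_mem (mem_cstar A i))⟩ fun x hx => ?_
    exact Submodule.le_topologicalClosure _ (Submodule.subset_span ⟨(1, ⟨x, hx⟩), rfl⟩)

end Full

/-! ### Compressions and dilations -/

section Compression

variable {d : ℕ} {G : Type u} [NormedAddCommGroup G] [InnerProductSpace ℂ G] [CompleteSpace G]
  {H : Type v} [NormedAddCommGroup H] [InnerProductSpace ℂ H] [CompleteSpace H]

/-- The adjoint of a compression to a co-invariant subspace is a plain restriction, so it suffices
to intertwine adjoints. -/
theorem unitarilyEquiv_compression {T : Fin d → H →L[ℂ] H} {A : Fin d → G →L[ℂ] G}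
    (Φ : H →ₗᵢ[ℂ] G) (K : ClosedSubmodule ℂ G) (hK : ∀ x, x ∈ K ↔ ∃ h, Φ h = x)
    (hstar : ∀ i h, star (A i) (Φ h) = Φ (star (T i) h)) :
    UnitarilyEquiv T (compression A K) := by
  let Ψ : H →ₗᵢ[ℂ] K.toSubmodule :=
    { Φ.toLinearMap.codRestrict K.toSubmodule fun h => (hK _).mpr ⟨h, rfl⟩ with
      norm_map' := fun h => Φ.norm_map h }
  have hΨ : Function.Surjective Ψ := fun ⟨x, hx⟩ => by
    obtain ⟨h, rfl⟩ := (hK x).mp hx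
    exact ⟨h, rfl⟩
  refine ⟨LinearIsometryEquiv.ofSurjective Ψ hΨ, fun i h => ?_⟩
  change Ψ (T i h) = compression A K i (Ψ h)
  refine ext_inner_right ℂ fun z => ?_
  obtain ⟨k, rfl⟩ := hΨ z
  change _ = inner ℂ (K.toSubmodule.orthogonalProjectionOnto (A i (Φ h))) (Ψ k)
  rw [Ψ.inner_map_map, Submodule.inner_orthogonalProjectionOnto_eq_of_mem_right]
  change _ = inner ℂ (A i (Φ h)) (Φ k)
  rw [← ContinuousLinearMap.adjoint_inner_right (A i), ← ContinuousLinearMap.star_eq_adjoint,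
    hstar, Φ.inner_map_map, ContinuousLinearMap.star_eq_adjoint,
    ContinuousLinearMap.adjoint_inner_right]

end Compression

section Direct

variable {E : Type u} {F : Type v} [NormedAddCommGroup E] [InnerProductSpace ℂ E]
  [NormedAddCommGroup F] [InnerProductSpace ℂ F]

theorem directSum_apply (A : E →L[ℂ] E) (B : F →L[ℂ] F) (x : E) (y : F) :
    directSum A B (WithLp.toLp 2 (x, y)) = WithLp.toLp 2 (A x, B y) := rfl

theorem star_directSum [CompleteSpace E] [CompleteSpace F] (A : E →L[ℂ] E) (B : F →L[ℂ] F) :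
    star (directSum A B) = directSum (star A) (star B) := by
  rw [ContinuousLinearMap.star_eq_adjoint, eq_comm, ContinuousLinearMap.eq_adjoint_iff]
  intro x y
  rw [WithLp.prod_inner_apply, WithLp.prod_inner_apply]
  change inner ℂ (star A x.fst) y.fst + inner ℂ (star B x.snd) y.snd =
    inner ℂ x.fst (A y.fst) + inner ℂ x.snd (B y.snd)
  rw [ContinuousLinearMap.star_eq_adjoint, ContinuousLinearMap.adjoint_inner_left,
    ContinuousLinearMap.star_eq_adjoint, ContinuousLinearMap.adjoint_inner_left]

end Direct

section Dilation

theorem modelTuple_apply {d : ℕ} {n : ℕ∞} {HZ : Type v} [NormedAddCommGroup HZ]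
    [InnerProductSpace ℂ HZ] (Z : Fin d → HZ →L[ℂ] HZ) (i : Fin d) (x : Copies n (H2 d)) (y : HZ) :
    modelTuple n Z i (WithLp.toLp 2 (x, y)) = WithLp.toLp 2 (shiftN d n i x, Z i y) := rfl

variable {d : ℕ} {H : Type u} [NormedAddCommGroup H] [InnerProductSpace ℂ H] [CompleteSpace H]
  {n : ℕ∞} {HZ : Type v} [NormedAddCommGroup HZ] [InnerProductSpace ℂ HZ] [CompleteSpace HZ]

theorem star_modelTuple_apply (Z : Fin d → HZ →L[ℂ] HZ) (i : Fin d) (x : Copies n (H2 d))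
    (y : HZ) : star (modelTuple n Z i) (WithLp.toLp 2 (x, y)) =
      WithLp.toLp 2 (star (shiftN d n i) x, star (Z i) y) := by
  rw [modelTuple, star_directSum, directSum_apply]

/-- `h ↦ (L h, R h)` is an isometry of `H` onto a full co-invariant subspace of `n · S ⊕ Z`,
and it intertwines the adjoints of `T` and of `n · S ⊕ Z`. -/
structure IsDilation (T : Fin d → H →L[ℂ] H) (Z : Fin d → HZ →L[ℂ] HZ)
    (L : H →L[ℂ] Copies n (H2 d)) (R : H →L[ℂ] HZ) : Prop where
  spherical : IsSphericalUnitary Z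
  star_shift : ∀ i h, star (shiftN d n i) (L h) = L (star (T i) h)
  star_sph : ∀ i h, star (Z i) (R h) = R (star (T i) h)
  inner_add : ∀ h k, inner ℂ (L h) (L k) + inner ℂ (R h) (R k) = inner ℂ h k
  full : ∀ M : Submodule ℂ (ModelSpace d n HZ), IsReducing (modelTuple n Z) M →
    (∀ h, WithLp.toLp 2 (L h, R h) ∈ M) → M = ⊤

variable {T : Fin d → H →L[ℂ] H} {Z : Fin d → HZ →L[ℂ] HZ}

theorem IsModel.exists_isDilation {K : ClosedSubmodule ℂ (ModelSpace d n HZ)}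
    (hK : IsModel T n Z K) :
    ∃ (L : H →L[ℂ] Copies n (H2 d)) (R : H →L[ℂ] HZ), IsDilation T Z L R ∧
      ∀ x, x ∈ K ↔ ∃ h, x = WithLp.toLp 2 (L h, R h) := by
  obtain ⟨U, hU⟩ := hK.equiv
  let Φ : H →L[ℂ] ModelSpace d n HZ := K.toSubmodule.subtypeL ∘L (U : H →L[ℂ] K.toSubmodule)
  have hΦ : ∀ h, Φ h = U h := fun h => rfl
  have hinner : ∀ h k, inner ℂ (Φ h) (Φ k) = inner ℂ h k := fun h k => U.inner_map_map h k
  -- By co-invariance the left side lies in K, so it is enough to test it against vectors of K,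
  -- where the projection in the compression drops out.
  have hstar : ∀ i h, star (modelTuple n Z i) (Φ h) = Φ (star (T i) h) := fun i h => by
    have hm : star (modelTuple n Z i) (Φ h) ∈ K := hK.coinvariant i _ (U h).2
    have : (⟨star (modelTuple n Z i) (Φ h), hm⟩ : K.toSubmodule) = U (star (T i) h) := by
      refine ext_inner_right ℂ fun z => ?_
      obtain ⟨k, rfl⟩ := U.surjective z
      rw [U.inner_map_map, ContinuousLinearMap.star_eq_adjoint (T i),
        ContinuousLinearMap.adjoint_inner_left, ← U.inner_map_map, hU]
      change inner ℂ (star (modelTuple n Z i) (Φ h)) (Φ k) = inner ℂ (U h)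
        (K.toSubmodule.orthogonalProjectionOnto (modelTuple n Z i (U k)))
      rw [Submodule.inner_orthogonalProjectionOnto_eq_of_mem_left,
        ContinuousLinearMap.star_eq_adjoint, ContinuousLinearMap.adjoint_inner_left]
      rfl
    exact congrArg Subtype.val this
  have hpair : ∀ h, Φ h = WithLp.toLp 2 ((Φ h).fst, (Φ h).snd) := fun h => rfl
  refine ⟨WithLp.fstL 2 ℂ _ _ ∘L Φ, WithLp.sndL 2 ℂ _ _ ∘L Φ,
    ⟨hK.spherical, fun i h => ?_, fun i h => ?_, fun h k => ?_, fun M hM h => ?_⟩, fun x => ?_⟩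
  · have := congrArg WithLp.fst (hstar i h)
    rwa [hpair h, star_modelTuple_apply] at this
  · have := congrArg WithLp.snd (hstar i h)
    rwa [hpair h, star_modelTuple_apply] at this
  · rw [← hinner, WithLp.prod_inner_apply]
    rfl
  · refine (isFull_iff _ K).mp hK.full M hM fun x hx => ?_
    have := h (U.symm ⟨x, hx⟩)
    have e : Φ (U.symm ⟨x, hx⟩) = x := by rw [hΦ, U.apply_symm_apply]
    rw [← e]
    exact this
  · constructor
    · intro hx
      refine ⟨U.symm ⟨x, hx⟩, ?_⟩
      change x = Φ (U.symm ⟨x, hx⟩)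
      rw [hΦ, U.apply_symm_apply]
    · rintro ⟨h, rfl⟩
      exact (U h).2

/-- The range of a dilation is a model. -/
theorem IsDilation.exists_isModel {L : H →L[ℂ] Copies n (H2 d)} {R : H →L[ℂ] HZ}
    (hD : IsDilation T Z L R) : ∃ K : ClosedSubmodule ℂ (ModelSpace d n HZ), IsModel T n Z K := by
  let Φ : H →ₗᵢ[ℂ] ModelSpace d n HZ :=
    { toFun := fun h => WithLp.toLp 2 (L h, R h)
      map_add' := fun h k => by simp only [map_add]; rfl
      map_smul' := fun c h => by simp only [map_smul]; rfl
      norm_map' := fun h => by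
        have : inner ℂ (WithLp.toLp 2 (L h, R h) : ModelSpace d n HZ) (WithLp.toLp 2 (L h, R h)) =
            inner ℂ h h := by
          rw [WithLp.prod_inner_apply]
          exact hD.inner_add h h
        change ‖(WithLp.toLp 2 (L h, R h) : ModelSpace d n HZ)‖ = ‖h‖
        rw [@norm_eq_sqrt_re_inner ℂ, this, ← @norm_eq_sqrt_re_inner ℂ] }
  let K : ClosedSubmodule ℂ (ModelSpace d n HZ) :=
    ⟨LinearMap.range Φ.toLinearMap, Φ.isometry.isClosedEmbedding.isClosed_range⟩
  have hstar : ∀ i h, star (modelTuple n Z i) (Φ h) = Φ (star (T i) h) := fun i h => by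
    change star (modelTuple n Z i) (WithLp.toLp 2 (L h, R h)) = WithLp.toLp 2 (L _, R _)
    rw [star_modelTuple_apply, hD.star_shift, hD.star_sph]
  refine ⟨K, hD.spherical, ?_, (isFull_iff _ _).mpr fun M hM h => hD.full M hM fun k => ?_,
    unitarilyEquiv_compression Φ K (fun x => Iff.rfl) hstar⟩
  · rintro i _ ⟨h, rfl⟩
    exact ⟨star (T i) h, (hstar i h).symm⟩
  · exact h _ ⟨k, rfl⟩

end Dilation

theorem multiindex_induction {d : ℕ} {P : (Fin d →₀ ℕ) → Prop} (h0 : P 0)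
    (h : ∀ α i, P α → P (α + Finsupp.single i 1)) (α : Fin d →₀ ℕ) : P α := by
  generalize hk : deg α = k
  induction k generalizing α with
  | zero => rw [deg_eq_zero.mp hk]; exact h0
  | succ k ih =>
    have : ∃ i, α i ≠ 0 := by
      by_contra! h'
      have : α = 0 := Finsupp.ext h'
      simp [this] at hk
    obtain ⟨i, hi⟩ := this
    rw [← sub_single_add_single hi]
    exact h _ _ (ih _ (by have := deg_sub_single hi; omega))

/-- This is Fuglede's theorem. -/
theorem IsSphericalUnitary.commute_star {d : ℕ} {E : Type u} [NormedAddCommGroup E]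
    [InnerProductSpace ℂ E] [CompleteSpace E] {Z : Fin d → E →L[ℂ] E}
    (hZ : IsSphericalUnitary Z) (i j : Fin d) : Commute (star (Z i)) (Z j) :=
  (hZ.normal i).commute_star_left (hZ.commute i j)

theorem IsSphericalUnitary.sum_inner_star {d : ℕ} {E : Type u} [NormedAddCommGroup E]
    [InnerProductSpace ℂ E] [CompleteSpace E] {Z : Fin d → E →L[ℂ] E}
    (hZ : IsSphericalUnitary Z) (x y : E) :
    ∑ i, inner ℂ (star (Z i) x) (star (Z i) y) = inner ℂ x y := by
  have h := inner_Theta Z 1 x y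
  simp only [clm_one_apply] at h
  rw [← h, Theta]
  simp only [mul_one, hZ.sum_eq_one, clm_one_apply]

/-! ### What a dilation of T is forced to be -/

section Dilation

variable {d : ℕ} {H : Type u} [NormedAddCommGroup H] [InnerProductSpace ℂ H] [CompleteSpace H]
  {n : ℕ∞} {HZ : Type v} [NormedAddCommGroup HZ] [InnerProductSpace ℂ HZ] [CompleteSpace HZ]
  {T : Fin d → H →L[ℂ] H} {Z : Fin d → HZ →L[ℂ] HZ}
  {L : H →L[ℂ] Copies n (H2 d)} {R : H →L[ℂ] HZ}

/-- The operator `E₀ L : H → ℓ²(n)`, the constant terms of `L`. -/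
def constTerm (L : H →L[ℂ] Copies n (H2 d)) : H →L[ℂ] Copies n ℂ :=
  ContinuousLinearMap.adjoint (vac d n) ∘L L

namespace IsDilation

/-- Add the defect identities of n·S at L and of Z at R. Since Σ Z_i Z_i^* = I, the whole defect of
T comes from the constant terms of L. -/
theorem inner_constTerm (hD : IsDilation T Z L R) (h k : H) :
    inner ℂ (constTerm L h) (constTerm L k) = inner ℂ ((1 - Theta T 1) h) k := by
  have h1 := sum_inner_star_shift (L h) (L k)
  have h2 := hD.spherical.sum_inner_star (R h) (R k)
  simp only [hD.star_shift, hD.star_sph] at h1 h2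
  rw [sub_apply, inner_sub_left, inner_Theta]
  simp only [clm_one_apply, ← hD.inner_add]
  rw [Finset.sum_add_distrib, h2, ← h1]
  simp only [constTerm, ContinuousLinearMap.comp_apply]
  ring

/-- Moments of `L`: `⟪z ^ α ⊗ c, L h⟫` is determined by `T` and the constant terms of `L`. -/
theorem exists_moment (T : Fin d → H →L[ℂ] H) (α : Fin d →₀ ℕ) :
    ∃ X : H →L[ℂ] H, ∀ {n : ℕ∞} {L : H →L[ℂ] Copies n (H2 d)},
      (∀ i h, star (shiftN d n i) (L h) = L (star (T i) h)) →
      ∀ c h, inner ℂ (tens (mono α) c) (L h) = inner ℂ c (constTerm L (X h)) := by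
  -- X is a product of operators T_i^*. It is chosen before n and L, so that any two dilations of T
  -- share it.
  induction α using multiindex_induction with
  | h0 => exact ⟨1, fun _ c h => (ContinuousLinearMap.adjoint_inner_right (vac d _) c _).symm⟩
  | h α i ih =>
    obtain ⟨X, hX⟩ := ih
    refine ⟨X * star (T i), fun hL c h => ?_⟩
    rw [← shiftN_tens, ← ContinuousLinearMap.adjoint_inner_right,
      ← ContinuousLinearMap.star_eq_adjoint, hL, hX hL]
    rfl

/-- If c is orthogonal to all constant terms, the vectors (z^α ⊗ c, 0) span a subspace invariant
under the tuple and its adjoints and, by the moment formula, orthogonal to all (L h, R h). Fullness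
forces c = 0. -/
theorem constTerm_total (hD : IsDilation T Z L R) :
    (Submodule.span ℂ (Set.range (constTerm L))).topologicalClosure = ⊤ := by
  refine total_of_orthogonal fun c hc => ?_
  let f : (Fin d →₀ ℕ) → ModelSpace d n HZ := fun α => WithLp.toLp 2 (tens (mono α) c, 0)
  have hM : IsReducing (modelTuple n Z) (Submodule.span ℂ (Set.range f))ᗮ := by
    refine ⟨Submodule.isClosed_orthogonal _, fun i x hx => ?_, fun i x hx => ?_⟩ <;>
      rw [mem_orthogonal_span_range] at hx ⊢ <;> intro α
    · rw [← ContinuousLinearMap.adjoint_inner_left, ← ContinuousLinearMap.star_eq_adjoint,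
        star_modelTuple_apply, star_shiftN_tens, map_zero]
      have : (WithLp.toLp 2 (((α i : ℂ) / (deg α : ℂ)) •
          tens (mono (α - Finsupp.single i 1)) c, 0) : ModelSpace d n HZ) =
          ((α i : ℂ) / (deg α : ℂ)) • f (α - Finsupp.single i 1) := by
        change _ = WithLp.toLp 2 (_ • (_, _))
        rw [Prod.smul_mk, smul_zero]
      rw [this, inner_smul_left, hx, mul_zero]
    · rw [ContinuousLinearMap.star_eq_adjoint, ContinuousLinearMap.adjoint_inner_right,
        modelTuple_apply, shiftN_tens, map_zero]
      exact hx _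
  have htop := hD.full _ hM fun h => by
    rw [mem_orthogonal_span_range]
    intro α
    obtain ⟨X, hX⟩ := exists_moment T α
    rw [WithLp.prod_inner_apply]
    change inner ℂ (tens (mono α) c) (L h) + inner ℂ (0 : HZ) (R h) = 0
    rw [hX hD.star_shift, inner_zero_left, add_zero, ← inner_conj_symm, hc, map_zero]
  have h0 : f 0 ∈ (Submodule.span ℂ (Set.range f))ᗮ := htop ▸ Submodule.mem_top
  have h1 := mem_orthogonal_span_range.mp h0 0
  have h2 : f 0 = 0 := inner_self_eq_zero.mp h1
  have h3 : vac d n c = 0 := congrArg WithLp.fst h2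
  rw [← adjoint_vac_vac (d := d) c, h3, map_zero]

/-- The closed span Y of these vectors reduces Z, since Z_i^* Z_w R h = Z_w R T_i^* h. Then n·H²_d ⊕
Y is reducing and contains the range of the dilation, so fullness applies. -/
theorem sph_total (hD : IsDilation T Z L R) :
    (Submodule.span ℂ (Set.range fun p : List (Fin d) × H =>
      wordOp Z p.1 (R p.2))).topologicalClosure = ⊤ := by
  set f := fun p : List (Fin d) × H => wordOp Z p.1 (R p.2) with hf
  set Y := (Submodule.span ℂ (Set.range f)).topologicalClosure with hY
  have hmem : ∀ p, f p ∈ Y := fun p =>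
    Submodule.le_topologicalClosure _ (Submodule.subset_span ⟨p, rfl⟩)
  have hM : IsReducing (modelTuple n Z) (Y.comap (WithLp.sndL 2 ℂ (Copies n (H2 d)) HZ).toLinearMap) := by
    refine ⟨(Submodule.isClosed_topologicalClosure _).preimage
      (WithLp.sndL 2 ℂ (Copies n (H2 d)) HZ).continuous, fun i x hx => ?_, fun i x hx => ?_⟩
    · change Z i x.snd ∈ Y
      refine map_closure_span_le (fun ⟨w, h⟩ => ?_) hx
      have : Z i (f (w, h)) = f (i :: w, h) := by
        simp only [hf, wordOp_cons, clm_mul_apply]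
      rw [this]
      exact hmem _
    · have : (star (modelTuple n Z i) x).snd = star (Z i) x.snd := by
        have := star_modelTuple_apply (n := n) Z i x.fst x.snd
        exact congrArg WithLp.snd this
      change (star (modelTuple n Z i) x).snd ∈ Y
      rw [this]
      refine map_closure_span_le (fun ⟨w, h⟩ => ?_) hx
      have : star (Z i) (f (w, h)) = f (w, star (T i) h) := by
        simp only [hf, ← hD.star_sph, ← clm_mul_apply,
          (commute_wordOp (hD.spherical.commute_star i) w).eq]
      rw [this]
      exact hmem _
  have htop := hD.full _ hM fun h => hmem ([], h)
  rw [eq_top_iff]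
  intro y _
  have : (WithLp.toLp 2 (0, y) : ModelSpace d n HZ) ∈
      Y.comap (WithLp.sndL 2 ℂ (Copies n (H2 d)) HZ).toLinearMap := htop ▸ Submodule.mem_top
  exact this

theorem inner_Theta_iterate (hD : IsDilation T Z L R) (m : ℕ) (h k : H) :
    inner ℂ ((Theta T)^[m] 1 h) k =
      inner ℂ ((Theta (shiftN d n))^[m] 1 (L h)) (L k) + inner ℂ (R h) (R k) := by
  induction m generalizing h k with
  | zero => exact (hD.inner_add h k).symm
  | succ m ih =>
    rw [Theta_iterate_succ, Theta_iterate_succ, inner_Theta, inner_Theta,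
      ← hD.spherical.sum_inner_star, ← Finset.sum_add_distrib]
    simp only [hD.star_shift, hD.star_sph, ih]

/-- Purity of n·S removes the first summand of `inner_Theta_iterate`. Thus R*R depends on T alone.
-/
theorem tendsto_inner_Theta_iterate (hD : IsDilation T Z L R) (h k : H) :
    Tendsto (fun m => inner ℂ ((Theta T)^[m] 1 h) k) atTop (𝓝 (inner ℂ (R h) (R k))) := by
  simp only [hD.inner_Theta_iterate]
  have := ((isPure_shiftN (d := d) (n := n) (L h)).inner (𝕜 := ℂ)
    (tendsto_const_nhds (x := L k))).add_const (inner ℂ (R h) (R k))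
  simpa using this

theorem subsingleton_iff_isPure (hT : Theta T 1 ≤ 1) (hD : IsDilation T Z L R) :
    Subsingleton HZ ↔ IsPure T := by
  constructor
  · intro _ h
    have h1 := hD.tendsto_inner_Theta_iterate h h
    rw [Subsingleton.elim (R h) 0, inner_zero_left] at h1
    have h2 : Tendsto (fun m => (inner ℂ ((Theta T)^[m] 1 h) h).re) atTop (𝓝 0) := by
      simpa [Function.comp_def] using (Complex.continuous_re.tendsto 0).comp h1
    have h3 : Tendsto (fun m => ‖(Theta T)^[m] 1 h‖ ^ 2) atTop (𝓝 0) :=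
      squeeze_zero (fun _ => by positivity) (fun m =>
        norm_apply_sq_le_of_le_one (Theta_iterate_mem hT m).1 (Theta_iterate_mem hT m).2 h) h2
    rw [tendsto_zero_iff_norm_tendsto_zero]
    have h4 := h3.sqrt
    simpa using h4
  · intro hp
    have hR : ∀ h, R h = 0 := fun h => by
      have h1 := hD.tendsto_inner_Theta_iterate h h
      have h2 := (hp h).inner (𝕜 := ℂ) (tendsto_const_nhds (x := h))
      rw [inner_zero_left] at h2
      exact inner_self_eq_zero.mp (tendsto_nhds_unique h1 h2)
    refine subsingleton_of_forall_eq 0 fun y => ?_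
    refine eq_of_inner_total hD.sph_total fun ⟨w, h⟩ => ?_
    simp [hR]

end IsDilation
end Dilation

theorem toENat_rank_copies (n : ℕ∞) :
    Cardinal.toENat (Module.rank ℂ (Copies n ℂ)) = n := by
  classical
  induction n using ENat.recTopCoe with
  | top =>
    rw [Cardinal.toENat_eq_top]
    have ho : Orthonormal ℂ fun k : Idx ⊤ => (lp.single 2 k (1 : ℂ) : Copies ⊤ ℂ) := by
      rw [orthonormal_iff_ite]
      intro i j
      rw [lp.inner_single_left, lp.single_apply]
      by_cases h : i = j
      · subst h; simp
      · simp [h]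
    have := ho.linearIndependent.cardinal_le_rank
    refine le_trans ?_ this
    rw [Cardinal.aleph0_le_mk_iff]
    exact Infinite.of_injective (fun k : ℕ => (⟨k, by simp⟩ : Idx ⊤))
      fun a b h => by simpa using h
  | coe m =>
    have e : Idx (m : ℕ∞) ≃ Fin m :=
      (Equiv.subtypeEquivRight fun k => by simp).trans Fin.equivSubtype.symm
    have : Fintype (Idx (m : ℕ∞)) := Fintype.ofEquiv _ e.symm
    have hc : Fintype.card (Idx (m : ℕ∞)) = m := by
      rw [Fintype.card_congr e, Fintype.card_fin]
    have l := (lpPiLpₗᵢ (p := 2) (fun _ : Idx (m : ℕ∞) => ℂ) ℂ).toLinearEquiv.trans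
      (WithLp.linearEquiv 2 ℂ (Idx (m : ℕ∞) → ℂ))
    rw [l.rank_eq, rank_fun', hc, Cardinal.toENat_nat]

/-! ### The defect space -/

section Defect

variable {d : ℕ} {H : Type u} [NormedAddCommGroup H] [InnerProductSpace ℂ H] [CompleteSpace H]
  {T : Fin d → H →L[ℂ] H}

theorem inner_defect (hT : Theta T 1 ≤ 1) (h k : H) :
    inner ℂ (defect T h) (defect T k) = inner ℂ ((1 - Theta T 1) h) k := by
  have hsa : star (defect T) = defect T := (IsSelfAdjoint.of_nonneg (CFC.sqrt_nonneg _)).star_eq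
  have hsq : defect T * defect T = 1 - Theta T 1 :=
    CFC.sqrt_mul_sqrt_self _ (sub_nonneg.mpr hT)
  rw [← hsq, clm_mul_apply]
  conv_rhs => rw [← hsa]
  rw [ContinuousLinearMap.star_eq_adjoint, ContinuousLinearMap.adjoint_inner_left,
    ← ContinuousLinearMap.star_eq_adjoint, hsa]

/-- The defect operator as a map into the defect space. -/
def defectVec (T : Fin d → H →L[ℂ] H) (h : H) : defectSpace T :=
  ⟨defect T h, Submodule.le_topologicalClosure _ ⟨h, rfl⟩⟩

instance : CompleteSpace (defectSpace T) :=
  (Submodule.isClosed_topologicalClosure _).completeSpace_coe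

theorem defectVec_total (T : Fin d → H →L[ℂ] H) :
    (Submodule.span ℂ (Set.range (defectVec T))).topologicalClosure = ⊤ := by
  refine total_of_orthogonal fun ⟨x, hx⟩ h => ?_
  have h1 : x ∈ (LinearMap.range (defect T).toLinearMap)ᗮ := by
    rintro _ ⟨y, rfl⟩
    exact h y
  rw [← Submodule.orthogonal_closure] at h1
  exact Subtype.ext (inner_self_eq_zero.mp (h1 x hx))

end Defect

/-! ### Rank formula and uniqueness -/

section Uniqueness

variable {d : ℕ} {H : Type u} [NormedAddCommGroup H] [InnerProductSpace ℂ H] [CompleteSpace H]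
  {n : ℕ∞} {HZ : Type v} [NormedAddCommGroup HZ] [InnerProductSpace ℂ HZ] [CompleteSpace HZ]
  {HZ' : Type w} [NormedAddCommGroup HZ'] [InnerProductSpace ℂ HZ'] [CompleteSpace HZ']
  {T : Fin d → H →L[ℂ] H} {Z : Fin d → HZ →L[ℂ] HZ} {Z' : Fin d → HZ' →L[ℂ] HZ'}
  {L L' : H →L[ℂ] Copies n (H2 d)} {R : H →L[ℂ] HZ} {R' : H →L[ℂ] HZ'}

namespace IsDilation

/-- Δ_T h and the constant term of L h are total families with the same Gram matrix, so the defect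
space is unitarily ℓ²(n). -/
theorem eq_rank (hT : Theta T 1 ≤ 1) (hD : IsDilation T Z L R) : n = rank T := by
  obtain ⟨U, -⟩ := exists_linearIsometryEquiv_of_inner_eq (defectVec T) (constTerm L)
    (defectVec_total T) hD.constTerm_total fun h k => by
      rw [hD.inner_constTerm, ← inner_defect hT]
      rfl
  have h1 := congrArg Cardinal.toENat U.toLinearEquiv.lift_rank_eq
  rw [Cardinal.toENat_lift, Cardinal.toENat_lift, toENat_rank_copies] at h1
  exact h1.symm

theorem constTerm_monomials_total (hD : IsDilation T Z L R) :
    (Submodule.span ℂ (Set.range fun p : (Fin d →₀ ℕ) × H =>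
      tens (mono p.1) (constTerm L p.2))).topologicalClosure = ⊤ := by
  refine total_of_orthogonal fun x hx => ?_
  refine eq_of_inner_total monomials_total fun ⟨α, c⟩ => ?_
  rw [inner_zero_right, ← ContinuousLinearMap.adjoint_inner_right]
  have : ContinuousLinearMap.adjoint (tens (mono α)) x = 0 :=
    eq_of_inner_total hD.constTerm_total fun h => by
      rw [ContinuousLinearMap.adjoint_inner_right, hx (α, h), inner_zero_right]
  rw [this, inner_zero_right]

/-- W sends z^α ⊗ ε h to z^α ⊗ ε' h, where ε and ε' are the constant terms of L and L'. The shifts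
change only α, so W commutes with them. -/
theorem exists_shift_equiv (hD : IsDilation T Z L R) (hD' : IsDilation T Z' L' R') :
    ∃ W : Copies n (H2 d) ≃ₗᵢ[ℂ] Copies n (H2 d),
      (∀ i x, W (shiftN d n i x) = shiftN d n i (W x)) ∧ ∀ h, W (L h) = L' h := by
  classical
  obtain ⟨W, hW⟩ := exists_linearIsometryEquiv_of_inner_eq _ _ hD.constTerm_monomials_total
    hD'.constTerm_monomials_total fun p q => by
      simp only [inner_tens_tens, hD.inner_constTerm, hD'.inner_constTerm]
  refine ⟨W, fun i x => ?_, fun h => ?_⟩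
  · have : (W : Copies n (H2 d) →L[ℂ] Copies n (H2 d)) ∘L shiftN d n i =
        shiftN d n i ∘L (W : Copies n (H2 d) →L[ℂ] Copies n (H2 d)) :=
      clm_ext_of_total hD.constTerm_monomials_total fun ⟨α, h⟩ => by
        change W (shiftN d n i (tens (mono α) (constTerm L h))) =
          shiftN d n i (W (tens (mono α) (constTerm L h)))
        rw [hW (α, h), shiftN_tens, shiftN_tens]
        exact hW (α + Finsupp.single i 1, h)
    exact congrArg (fun A : Copies n (H2 d) →L[ℂ] Copies n (H2 d) => A x) this
  -- The moments of L and L' involve the same X, and the Gram matrices of ε and ε' agree.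
  · refine eq_of_inner_total hD'.constTerm_monomials_total fun ⟨α, k⟩ => ?_
    obtain ⟨X, hX⟩ := exists_moment T α
    rw [hX hD'.star_shift, ← hW (α, k), W.inner_map_map, hX hD.star_shift, hD.inner_constTerm,
      hD'.inner_constTerm]

/-- Normality and commutativity move every Z to the other side as an adjoint, and R absorbs adjoints
into T_i^*. The Gram matrix of the vectors Z_w R h is thus a function of R*R and T. -/
theorem inner_wordOp (hD : IsDilation T Z L R) (v w : List (Fin d)) (h k : H) :
    inner ℂ (wordOp Z v (R h)) (wordOp Z w (R k)) =
      inner ℂ (R (wordOp (fun i => star (T i)) w.reverse h))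
        (R (wordOp (fun i => star (T i)) v.reverse k)) := by
  have hw : ∀ (w : List (Fin d)) x y, inner ℂ x (wordOp Z w y) =
      inner ℂ (wordOp (fun i => star (Z i)) w.reverse x) y := fun w => by
    induction w with
    | nil => intro x y; rfl
    | cons i w ih =>
      intro x y
      rw [wordOp_cons, clm_mul_apply, ← ContinuousLinearMap.adjoint_inner_left, ih]
      simp [wordOp, ContinuousLinearMap.star_eq_adjoint]
  have hR : ∀ (w : List (Fin d)) h, wordOp (fun i => star (Z i)) w (R h) =
      R (wordOp (fun i => star (T i)) w h) := fun w => by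
    induction w with
    | nil => intro h; rfl
    | cons i w ih => intro h; simp only [wordOp_cons, clm_mul_apply, ih, hD.star_sph]
  have hc : ∀ (w : List (Fin d)) (v : List (Fin d)) x, wordOp (fun i => star (Z i)) w (wordOp Z v x) =
      wordOp Z v (wordOp (fun i => star (Z i)) w x) := fun w v x =>
    congrArg (fun A : HZ →L[ℂ] HZ => A x) (commute_wordOp (fun j =>
      (commute_wordOp (fun i => (hD.spherical.commute_star i j).symm) w).symm) v).eq
  rw [hw, hc, hR, ← inner_conj_symm, hw, hR, inner_conj_symm]

theorem exists_sph_equiv (hD : IsDilation T Z L R) (hD' : IsDilation T Z' L' R') :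
    ∃ V : HZ ≃ₗᵢ[ℂ] HZ', (∀ i y, V (Z i y) = Z' i (V y)) ∧ ∀ h, V (R h) = R' h := by
  have hRR : ∀ h k, inner ℂ (R h) (R k) = inner ℂ (R' h) (R' k) := fun h k =>
    tendsto_nhds_unique (hD.tendsto_inner_Theta_iterate h k) (hD'.tendsto_inner_Theta_iterate h k)
  obtain ⟨V, hV⟩ := exists_linearIsometryEquiv_of_inner_eq _ _ hD.sph_total hD'.sph_total
    fun p q => by rw [hD.inner_wordOp, hD'.inner_wordOp, hRR]
  refine ⟨V, fun i y => ?_, fun h => hV ([], h)⟩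
  have : (V : HZ →L[ℂ] HZ') ∘L Z i = Z' i ∘L (V : HZ →L[ℂ] HZ') :=
    clm_ext_of_total hD.sph_total fun ⟨w, h⟩ => by
      change V (Z i (wordOp Z w (R h))) = Z' i (V (wordOp Z w (R h)))
      rw [hV (w, h)]
      exact hV (i :: w, h)
  exact congrArg (fun A : HZ →L[ℂ] HZ' => A y) this

end IsDilation

theorem IsModel.tripleEquiv (hT : Theta T 1 ≤ 1) {n' : ℕ∞}
    {K : ClosedSubmodule ℂ (ModelSpace d n HZ)} {K' : ClosedSubmodule ℂ (ModelSpace d n' HZ')}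
    (hK : IsModel T n Z K) (hK' : IsModel T n' Z' K') : TripleEquiv n Z K n' Z' K' := by
  obtain ⟨L, R, hD, hm⟩ := hK.exists_isDilation
  obtain ⟨L', R', hD', hm'⟩ := hK'.exists_isDilation
  obtain rfl : n = n' := (hD.eq_rank hT).trans (hD'.eq_rank hT).symm
  obtain ⟨W, hWS, hWL⟩ := hD.exists_shift_equiv hD'
  obtain ⟨V, hVZ, hVR⟩ := hD.exists_sph_equiv hD'
  refine ⟨rfl, W, V, hWS, hVZ, fun x y => ?_⟩
  rw [hm, hm']
  refine exists_congr fun h => ?_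
  rw [← hWL, ← hVR]
  simp only [WithLp.toLp.injEq, Prod.mk.injEq, EmbeddingLike.apply_eq_iff_eq]

end Uniqueness

/-! ### Separability and ℓ²(n) -/

section Countable

/-- Distinct orthonormal vectors are at distance √2 > 1, so balls of radius 1/2 around them are
disjoint. -/
theorem countable_of_orthonormal {ι : Type*} {E : Type*} [NormedAddCommGroup E]
    [InnerProductSpace ℂ E] [TopologicalSpace.SeparableSpace E] {v : ι → E}
    (hv : Orthonormal ℂ v) : Countable ι := by
  refine Pairwise.countable_of_isOpen_disjoint (s := fun i => Metric.ball (v i) (1 / 2))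
    (fun i j hij => Metric.ball_disjoint_ball ?_) (fun i => Metric.isOpen_ball)
    fun i => Metric.nonempty_ball.mpr (by norm_num)
  have h : ‖v i - v j‖ * ‖v i - v j‖ = 2 := by
    rw [norm_sub_mul_self (𝕜 := ℂ), hv.2 hij, hv.1 i, hv.1 j]
    norm_num
  rw [dist_eq_norm]
  nlinarith [norm_nonneg (v i - v j)]

theorem exists_idx_equiv (ι : Type*) [Countable ι] : ∃ n : ℕ∞, Nonempty (ι ≃ Idx n) := by
  rcases finite_or_infinite ι with _ | _
  · obtain ⟨m, ⟨e⟩⟩ := Finite.exists_equiv_fin ι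
    exact ⟨m, ⟨e.trans (Fin.equivSubtype.trans (Equiv.subtypeEquivRight fun k => by simp))⟩⟩
  · have : Infinite (Idx ⊤) := Infinite.of_injective (fun k : ℕ => (⟨k, by simp⟩ : Idx ⊤))
      fun a b h => by simpa using h
    exact ⟨⊤, nonempty_equiv_of_countable⟩

/-- A separable Hilbert space is unitarily equivalent to `ℓ²(n)` for some `n`. -/
theorem exists_equiv_copies (E : Type*) [NormedAddCommGroup E] [InnerProductSpace ℂ E]
    [CompleteSpace E] [TopologicalSpace.SeparableSpace E] :
    ∃ n : ℕ∞, Nonempty (E ≃ₗᵢ[ℂ] Copies n ℂ) := by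
  classical
  obtain ⟨s, b, -⟩ := exists_hilbertBasis ℂ E
  have := countable_of_orthonormal b.orthonormal
  obtain ⟨n, ⟨e⟩⟩ := exists_idx_equiv s
  obtain ⟨U, -⟩ := exists_linearIsometryEquiv_of_inner_eq b
    (fun i => (lp.single 2 (e i) (1 : ℂ) : Copies n ℂ)) b.dense_span
    (total_of_orthogonal fun x hx => by
      ext k
      have := hx (e.symm k)
      rw [lp.inner_single_left, e.apply_symm_apply] at this
      simpa using this)
    fun i j => by
      rw [orthonormal_iff_ite.mp b.orthonormal, lp.inner_single_left, lp.single_apply]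
      by_cases h : i = j
      · subst h; simp
      · simp [h, e.injective.ne h]
  exact ⟨n, ⟨U⟩⟩

theorem separableSpace_of_total {ι : Type*} [Countable ι] {E : Type*} [NormedAddCommGroup E]
    [InnerProductSpace ℂ E] {H : Type*} [TopologicalSpace H] [TopologicalSpace.SeparableSpace H]
    {f : ι × H → E} (hf : (Submodule.span ℂ (Set.range f)).topologicalClosure = ⊤)
    (hc : ∀ i, Continuous fun h => f (i, h)) : TopologicalSpace.SeparableSpace E := by
  have h1 : TopologicalSpace.IsSeparable (Set.range f) := by
    have : Set.range f = ⋃ i, Set.range fun h => f (i, h) := by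
      ext y
      simp
    rw [this]
    exact .iUnion fun i => TopologicalSpace.isSeparable_range (hc i)
  have h2 := (h1.span (R := ℂ)).closure
  rw [← Submodule.topologicalClosure_coe, hf] at h2
  exact TopologicalSpace.isSeparable_univ_iff.mp h2

end Countable

/-! ### Multi-index powers and the construction of L -/

section Powers

variable {d : ℕ} {H : Type u} [NormedAddCommGroup H] [InnerProductSpace ℂ H]

/-- The multi-index powers of a tuple. -/
def multiPow (V : Fin d → H →L[ℂ] H) (α : Fin d →₀ ℕ) : H →L[ℂ] H :=
  wordOp V (Finsupp.toMultiset α).toList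

theorem multiPow_zero (V : Fin d → H →L[ℂ] H) : multiPow V 0 = 1 := by
  simp [multiPow]

/-- Commutativity makes the arbitrary order chosen by `toList` irrelevant. -/
theorem multiPow_add_single {V : Fin d → H →L[ℂ] H} (hV : ∀ i j, Commute (V i) (V j))
    (α : Fin d →₀ ℕ) (i : Fin d) : multiPow V (α + Finsupp.single i 1) = multiPow V α * V i := by
  have hp : (Finsupp.toMultiset (α + Finsupp.single i 1)).toList.Perm
      (i :: (Finsupp.toMultiset α).toList) := by
    rw [← Multiset.coe_eq_coe, ← Multiset.cons_coe, Multiset.coe_toList, Multiset.coe_toList,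
      map_add, Finsupp.toMultiset_single, one_smul, add_comm, Multiset.singleton_add]
  have h : multiPow V (α + Finsupp.single i 1) = wordOp V (i :: (Finsupp.toMultiset α).toList) := by
    exact (hp.map V).prod_eq' (List.pairwise_map.mpr (List.pairwise_of_forall fun i j => hV i j))
  rw [h, wordOp_cons, (commute_wordOp (fun j => hV i j) _).eq, multiPow]

end Powers

section Moments

variable {d : ℕ} {H : Type u} [NormedAddCommGroup H] [InnerProductSpace ℂ H] [CompleteSpace H]
  {n : ℕ∞} {T : Fin d → H →L[ℂ] H} {ε : H →L[ℂ] Copies n ℂ}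

theorem norm_sq_constTerm (hε : ∀ h k, inner ℂ (ε h) (ε k) = inner ℂ ((1 - Theta T 1) h) k)
    (h : H) : ‖ε h‖ ^ 2 + ∑ i, ‖star (T i) h‖ ^ 2 = ‖h‖ ^ 2 := by
  have h1 := hε h h
  rw [sub_apply, inner_sub_left, inner_Theta, clm_one_apply] at h1
  simp only [clm_one_apply, inner_self_eq_norm_sq_to_K] at h1
  have h2 : ((‖ε h‖ ^ 2 : ℝ) : ℂ) = ((‖h‖ ^ 2 - ∑ i, ‖star (T i) h‖ ^ 2 : ℝ) : ℂ) := by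
    push_cast
    exact h1
  linarith [Complex.ofReal_injective h2]

/-- The inverse weights are multinomial coefficients, and 1/w(α) is the sum of 1/w(α − e_i) over i
with α_i ≠ 0. The terms with α ≠ 0 therefore split into d sums of lower degree, with h replaced by
T_i^* h. Induction bounds them by Σ ‖T_i^* h‖², and `norm_sq_constTerm` accounts for α = 0. -/
theorem sum_moments_le (hT : ∀ i j, Commute (star (T i)) (star (T j)))
    (hε : ∀ h k, inner ℂ (ε h) (ε k) = inner ℂ ((1 - Theta T 1) h) k) (N : ℕ) :
    ∀ (s : Finset (Fin d →₀ ℕ)), (∀ α ∈ s, deg α < N) → ∀ h : H,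
      ∑ α ∈ s, (weight α)⁻¹ * ‖ε (multiPow (fun i => star (T i)) α h)‖ ^ 2 ≤ ‖h‖ ^ 2 := by
  classical
  induction N with
  | zero =>
    intro s hs h
    have : s = ∅ := Finset.eq_empty_of_forall_notMem fun α hα => by simpa using hs α hα
    subst this
    simp
  | succ N ih =>
    intro s hs h
    set F : H → (Fin d →₀ ℕ) → ℝ := fun h α =>
      (weight α)⁻¹ * ‖ε (multiPow (fun i => star (T i)) α h)‖ ^ 2 with hF
    have hF0 : ∀ h α, 0 ≤ F h α := fun h α =>
      mul_nonneg (inv_nonneg.mpr (weight_pos α).le) (by positivity)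
    have hstep : ∀ α ∈ s.erase 0, F h α =
        ∑ i, if α i ≠ 0 then F (star (T i) h) (α - Finsupp.single i 1) else 0 := by
      intro α hα
      have hα0 : α ≠ 0 := (Finset.mem_erase.mp hα).1
      have hd : (deg α : ℝ) ≠ 0 := by exact_mod_cast mt deg_eq_zero.mp hα0
      have h1 : ∀ i, (if α i ≠ 0 then F (star (T i) h) (α - Finsupp.single i 1) else 0) =
          (α i : ℝ) / deg α * F h α := by
        intro i
        split_ifs with hi
        · have h2 : multiPow (fun i => star (T i)) (α - Finsupp.single i 1) (star (T i) h) =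
              multiPow (fun i => star (T i)) α h := by
            conv_rhs => rw [← sub_single_add_single hi, multiPow_add_single hT]
            rfl
          have h3 := deg_mul_weight hi
          have h4 := (weight_pos α).ne'
          have h5 := (weight_pos (α - Finsupp.single i 1)).ne'
          have h6 : (weight (α - Finsupp.single i 1))⁻¹ = (α i : ℝ) / deg α * (weight α)⁻¹ := by
            field_simp
            rw [h3, mul_comm]
          simp only [hF, h2, h6, mul_assoc]
        · simp [not_not.mp hi]
      rw [Finset.sum_congr rfl fun i _ => h1 i, ← Finset.sum_mul, ← Finset.sum_div,
        ← Nat.cast_sum]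
      change _ = (deg α : ℝ) / deg α * _
      rw [div_self hd, one_mul]
    have hi : ∀ i, ∑ α ∈ s.erase 0, (if α i ≠ 0 then
        F (star (T i) h) (α - Finsupp.single i 1) else 0) ≤ ‖star (T i) h‖ ^ 2 := by
      intro i
      -- Reindex by α ↦ α − e_i, which is injective only where α_i ≠ 0.
      rw [← Finset.sum_filter, ← Finset.sum_image (g := fun α => α - Finsupp.single i 1)]
      · refine ih _ (fun β hβ => ?_) _
        obtain ⟨α, hα, rfl⟩ := Finset.mem_image.mp hβ
        rw [Finset.mem_filter, Finset.mem_erase] at hα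
        have h1 := hs α hα.1.2
        have h2 := deg_sub_single hα.2
        omega
      · intro α hα β hβ he
        have hα' := (Finset.mem_filter.mp hα).2
        have hβ' := (Finset.mem_filter.mp hβ).2
        rw [← sub_single_add_single hα', ← sub_single_add_single hβ']
        exact congrArg (· + Finsupp.single i 1) he
    have hle : ∑ α ∈ s.erase 0, F h α ≤ ∑ i, ‖star (T i) h‖ ^ 2 := by
      rw [Finset.sum_congr rfl hstep, Finset.sum_comm]
      exact Finset.sum_le_sum fun i _ => hi i
    have h0 : F h 0 = ‖ε h‖ ^ 2 := by
      simp [hF, weight_zero, multiPow_zero]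
    calc ∑ α ∈ s, F h α ≤ ∑ α ∈ insert 0 (s.erase 0), F h α :=
          Finset.sum_le_sum_of_subset_of_nonneg (fun α hα => by
            by_cases h : α = 0 <;> simp [h, hα]) fun α _ _ => hF0 h α
      _ = ‖ε h‖ ^ 2 + ∑ α ∈ s.erase 0, F h α := by
          rw [Finset.sum_insert (Finset.notMem_erase 0 s), h0]
      _ ≤ ‖h‖ ^ 2 := by rw [← norm_sq_constTerm hε h]; linarith

/-- The normalized monomial embeddings `c ↦ z ^ α ⊗ c / ‖z ^ α‖`. -/
def monoIsometry (d : ℕ) (n : ℕ∞) (α : Fin d →₀ ℕ) : Copies n ℂ →ₗᵢ[ℂ] Copies n (H2 d) where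
  toLinearMap := (((√(weight α))⁻¹ : ℝ) : ℂ) • (tens (mono α) : Copies n ℂ →L[ℂ] _).toLinearMap
  norm_map' c := by
    classical
    have hw := Real.sqrt_pos.mpr (weight_pos α)
    have h : ‖(tens (mono α) c : Copies n (H2 d))‖ = √(weight α) * ‖c‖ := by
      have h1 : ((‖(tens (mono α) c : Copies n (H2 d))‖ ^ 2 : ℝ) : ℂ) =
          ((weight α * ‖c‖ ^ 2 : ℝ) : ℂ) := by
        have h2 := inner_tens_tens (mono α) (mono α) c c
        rw [inner_mono, if_pos rfl, inner_self_eq_norm_sq_to_K, inner_self_eq_norm_sq_to_K] at h2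
        push_cast
        exact h2
      rw [← sq_eq_sq₀ (norm_nonneg _) (by positivity), mul_pow, Real.sq_sqrt (weight_pos α).le]
      exact Complex.ofReal_injective h1
    change ‖(((√(weight α))⁻¹ : ℝ) : ℂ) • (tens (mono α) c : Copies n (H2 d))‖ = ‖c‖
    rw [norm_smul, h, Complex.norm_real, Real.norm_of_nonneg (by positivity), ← mul_assoc,
      inv_mul_cancel₀ hw.ne', one_mul]

theorem monoIsometry_apply (α : Fin d →₀ ℕ) (c : Copies n ℂ) :
    monoIsometry d n α c = (((√(weight α))⁻¹ : ℝ) : ℂ) • tens (mono α) c := rfl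

theorem orthogonalFamily_monoIsometry :
    OrthogonalFamily ℂ (fun _ : Fin d →₀ ℕ => Copies n ℂ) (monoIsometry d n) := by
  classical
  intro α β h b c
  simp only [monoIsometry_apply, inner_smul_left, inner_smul_right, inner_tens_tens, inner_mono,
    if_neg h, zero_mul, mul_zero]

/-- The contraction `L : H → n · H²_d` with prescribed constant terms `ε` that intertwines the
adjoints of `T` and of `n · S`. -/
theorem exists_poisson (hT : ∀ i j, Commute (star (T i)) (star (T j)))
    (hε : ∀ h k, inner ℂ (ε h) (ε k) = inner ℂ ((1 - Theta T 1) h) k) :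
    ∃ L : H →L[ℂ] Copies n (H2 d), (∀ h, ‖L h‖ ≤ ‖h‖) ∧ constTerm L = ε ∧
      ∀ i h, star (shiftN d n i) (L h) = L (star (T i) h) := by
  classical
  set P := multiPow fun i => star (T i)
  -- The coefficient of L h along the normalized monomial z^α/√w(α). The second factor w(α)^(−1/2)
  -- comes from `monoIsometry`.
  let g : H → (Fin d →₀ ℕ) → Copies n ℂ := fun h α => (((√(weight α))⁻¹ : ℝ) : ℂ) • ε (P α h)
  have hbound : ∀ h (s : Finset (Fin d →₀ ℕ)),
      ∑ α ∈ s, ‖g h α‖ ^ (2 : ENNReal).toReal ≤ ‖h‖ ^ (2 : ENNReal).toReal := by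
    intro h s
    have h1 : ∀ α, ‖g h α‖ ^ (2 : ENNReal).toReal = (weight α)⁻¹ * ‖ε (P α h)‖ ^ 2 := fun α => by
      rw [ENNReal.toReal_ofNat, Real.rpow_two, norm_smul, mul_pow, Complex.norm_real,
        Real.norm_of_nonneg (by positivity), inv_pow, Real.sq_sqrt (weight_pos α).le]
    rw [Finset.sum_congr rfl fun α _ => h1 α, ENNReal.toReal_ofNat, Real.rpow_two]
    exact sum_moments_le hT hε (s.sup deg + 1) s
      (fun α hα => Nat.lt_succ_of_le (Finset.le_sup hα)) h
  let G : H →ₗ[ℂ] lp (fun _ : Fin d →₀ ℕ => Copies n ℂ) 2 :=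
    { toFun := fun h => ⟨g h, memℓp_gen' (hbound h)⟩
      map_add' := fun h k => by
        ext1
        funext α
        change g (h + k) α = g h α + g k α
        simp only [g, map_add, smul_add]
      map_smul' := fun c h => by
        ext1
        funext α
        change g (c • h) α = c • g h α
        simp only [g, map_smul, smul_comm c] }
  have hG : ∀ h, ‖G h‖ ≤ ‖h‖ := fun h =>
    lp.norm_le_of_forall_sum_le (by norm_num) (norm_nonneg h) (hbound h)
  let I := (orthogonalFamily_monoIsometry (d := d) (n := n)).linearIsometry
  let L : H →L[ℂ] Copies n (H2 d) :=
    (I.toLinearMap ∘ₗ G).mkContinuous 1 fun h => by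
      rw [one_mul]
      exact (I.norm_map (G h)).trans_le (hG h)
  have hmom : ∀ α c h, inner ℂ (tens (mono α) c) (L h) = inner ℂ c (ε (P α h)) := by
    intro α c h
    have hw : ((√(weight α) : ℝ) : ℂ) ≠ 0 := by
      exact_mod_cast (Real.sqrt_pos.mpr (weight_pos α)).ne'
    have h1 : inner ℂ (monoIsometry d n α c) (I (G h)) = inner ℂ c (g h α) := by
      rw [← OrthogonalFamily.linearIsometry_apply_single orthogonalFamily_monoIsometry (i := α) c]
      change inner ℂ (I _) _ = _
      rw [I.inner_map_map, lp.inner_single_left]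
      rfl
    rw [monoIsometry_apply, inner_smul_left, inner_smul_right, Complex.conj_ofReal] at h1
    refine mul_left_cancel₀ ?_ h1
    push_cast
    exact inv_ne_zero hw
  refine ⟨L, fun h => (I.norm_map (G h)).trans_le (hG h), ?_, fun i h => ?_⟩
  · ext1 h
    refine ext_inner_left ℂ fun c => ?_
    rw [constTerm, ContinuousLinearMap.comp_apply, ContinuousLinearMap.adjoint_inner_right, vac,
      hmom]
    simp [P, multiPow_zero]
  · refine eq_of_inner_total monomials_total fun ⟨α, c⟩ => ?_
    rw [ContinuousLinearMap.star_eq_adjoint (shiftN d n i),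
      ContinuousLinearMap.adjoint_inner_right, shiftN_tens, hmom, hmom]
    simp only [P]
    rw [multiPow_add_single hT]
    rfl

end Moments

/-! ### Fullness from totality -/

section Reducing

variable {d : ℕ} {H : Type u} [NormedAddCommGroup H] [InnerProductSpace ℂ H] {n : ℕ∞}
  {L : H →L[ℂ] Copies n (H2 d)}

/-- A reducing subspace containing all `(L h, R h)` is everything. -/
theorem isReducing_full {HZ : Type v} [NormedAddCommGroup HZ] [InnerProductSpace ℂ HZ]
    [CompleteSpace HZ] {Z : Fin d → HZ →L[ℂ] HZ} {R : H →L[ℂ] HZ}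
    (hZ : IsSphericalUnitary Z)
    (hL : (Submodule.span ℂ (Set.range (constTerm L))).topologicalClosure = ⊤)
    (hR : (Submodule.span ℂ (Set.range fun p : List (Fin d) × H =>
        wordOp Z p.1 (R p.2))).topologicalClosure = ⊤)
    {M : Submodule ℂ (ModelSpace d n HZ)} (hM : IsReducing (modelTuple n Z) M)
    (h : ∀ h, WithLp.toLp 2 (L h, R h) ∈ M) : M = ⊤ := by
  let ι₁ : Copies n (H2 d) →L[ℂ] ModelSpace d n HZ :=
    (WithLp.prodContinuousLinearEquiv 2 ℂ (Copies n (H2 d)) HZ).symm.toContinuousLinearMap ∘L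
      ContinuousLinearMap.inl ℂ _ _
  let ι₂ : HZ →L[ℂ] ModelSpace d n HZ :=
    (WithLp.prodContinuousLinearEquiv 2 ℂ (Copies n (H2 d)) HZ).symm.toContinuousLinearMap ∘L
      ContinuousLinearMap.inr ℂ _ _
  have hsplit : ∀ x y, (WithLp.toLp 2 (x, y) : ModelSpace d n HZ) = ι₁ x + ι₂ y := fun x y => by
    change _ = WithLp.toLp 2 ((x, 0) + (0, y))
    rw [Prod.mk_add_mk, add_zero, zero_add]
  have hι₁ : ∀ i x, modelTuple n Z i (ι₁ x) = ι₁ (shiftN d n i x) := fun i x => by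
    change modelTuple n Z i (WithLp.toLp 2 (x, 0)) = WithLp.toLp 2 (shiftN d n i x, 0)
    rw [modelTuple_apply, map_zero]
  have hι₂ : ∀ i y, modelTuple n Z i (ι₂ y) = ι₂ (Z i y) := fun i y => by
    change modelTuple n Z i (WithLp.toLp 2 (0, y)) = WithLp.toLp 2 (0, Z i y)
    rw [modelTuple_apply, map_zero]
  -- For the model tuple A, I − Σ A_i A_i^* vanishes on H_Z and projects n·H²_d onto the constants.
  -- It maps M to itself, so it extracts the constant term of L k from (L k, R k).
  have hvac : ∀ h, ι₁ (vac d n (constTerm L h)) ∈ M := fun k => by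
    have h1 : ι₁ (vac d n (constTerm L k)) = WithLp.toLp 2 (L k, R k) -
        ∑ i, modelTuple n Z i (star (modelTuple n Z i) (WithLp.toLp 2 (L k, R k))) := by
      have h2 : ∑ i, Z i (star (Z i) (R k)) = R k := by
        have := congrArg (fun A : HZ →L[ℂ] HZ => A (R k)) hZ.sum_eq_one
        simpa [sum_apply] using this
      have h3 : ∀ i, modelTuple n Z i (star (modelTuple n Z i) (WithLp.toLp 2 (L k, R k))) =
          ι₁ (shiftN d n i (star (shiftN d n i) (L k))) + ι₂ (Z i (star (Z i) (R k))) := fun i => by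
        rw [star_modelTuple_apply, modelTuple_apply, hsplit]
      rw [Finset.sum_congr rfl fun i _ => h3 i, Finset.sum_add_distrib, ← map_sum, ← map_sum, h2,
        hsplit, add_sub_add_right_eq_sub, ← map_sub]
      congr 1
      rw [eq_sub_iff_add_eq, add_comm]
      exact shift_defect (L k)
    rw [h1]
    exact M.sub_mem (h k) (M.sum_mem fun i _ => hM.map_mem i _ (hM.star_mem i _ (h k)))
  have hconst : ∀ c, ι₁ (vac d n c) ∈ M := fun c => by
    have : M.comap (ι₁ ∘L vac d n).toLinearMap = ⊤ := eq_top_of_total_mem hL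
      (hM.isClosed.preimage (ι₁ ∘L vac d n).continuous) hvac
    have hc : c ∈ M.comap (ι₁ ∘L vac d n).toLinearMap := this ▸ Submodule.mem_top
    exact hc
  have hmono : ∀ α c, ι₁ (tens (mono α) c) ∈ M := fun α c => by
    induction α using multiindex_induction with
    | h0 => exact hconst c
    | h α i ih =>
      rw [← shiftN_tens, ← hι₁]
      exact hM.map_mem i _ ih
  have h1 : ∀ x, ι₁ x ∈ M := fun x => by
    have : M.comap ι₁.toLinearMap = ⊤ := eq_top_of_total_mem monomials_total
      (hM.isClosed.preimage ι₁.continuous) fun p => hmono p.1 p.2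
    have hx : x ∈ M.comap ι₁.toLinearMap := this ▸ Submodule.mem_top
    exact hx
  have hword : ∀ w k, ι₂ (wordOp Z w (R k)) ∈ M := fun w k => by
    induction w with
    | nil =>
      have := M.sub_mem (h k) (h1 (L k))
      rwa [hsplit, add_sub_cancel_left] at this
    | cons i w ih =>
      rw [wordOp_cons, clm_mul_apply, ← hι₂]
      exact hM.map_mem i _ ih
  have h2 : ∀ y, ι₂ y ∈ M := fun y => by
    have : M.comap ι₂.toLinearMap = ⊤ := eq_top_of_total_mem hR
      (hM.isClosed.preimage ι₂.continuous) fun p => hword p.1 p.2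
    have hy : y ∈ M.comap ι₂.toLinearMap := this ▸ Submodule.mem_top
    exact hy
  rw [eq_top_iff]
  intro x _
  have hx : x = ι₁ x.fst + ι₂ x.snd := hsplit x.fst x.snd
  rw [hx]
  exact M.add_mem (h1 _) (h2 _)

end Reducing

/-! ### Construction of a dilation -/

section Existence

variable {d : ℕ} {H : Type u} [NormedAddCommGroup H] [InnerProductSpace ℂ H] [CompleteSpace H]
  {T : Fin d → H →L[ℂ] H}

theorem exists_constTerm [TopologicalSpace.SeparableSpace H] (hT : Theta T 1 ≤ 1) :
    ∃ (n : ℕ∞) (ε : H →L[ℂ] Copies n ℂ),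
      (∀ h k, inner ℂ (ε h) (ε k) = inner ℂ ((1 - Theta T 1) h) k) ∧
      (Submodule.span ℂ (Set.range ε)).topologicalClosure = ⊤ := by
  have : TopologicalSpace.SeparableSpace (defectSpace T) := inferInstance
  obtain ⟨n, ⟨U⟩⟩ := exists_equiv_copies (defectSpace T)
  refine ⟨n, (U : defectSpace T →L[ℂ] Copies n ℂ) ∘L (defect T).codRestrict (defectSpace T)
    (fun h => (defectVec T h).2), fun h k => ?_, ?_⟩
  · rw [← inner_defect hT]
    exact U.inner_map_map _ _
  · refine total_of_orthogonal fun x hx => ?_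
    obtain ⟨y, rfl⟩ := U.surjective x
    have : y = 0 := eq_of_inner_total (defectVec_total T) fun h => by
      rw [inner_zero_right, ← U.inner_map_map]
      exact hx h
    rw [this, map_zero]

theorem exists_isDilation [TopologicalSpace.SeparableSpace H] (hT : IsDContraction T) :
    ∃ (n : ℕ∞) (HZ : Type u) (_ : NormedAddCommGroup HZ) (_ : InnerProductSpace ℂ HZ)
      (_ : CompleteSpace HZ) (_ : TopologicalSpace.SeparableSpace HZ)
      (Z : Fin d → HZ →L[ℂ] HZ) (L : H →L[ℂ] Copies n (H2 d)) (R : H →L[ℂ] HZ),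
      IsDilation T Z L R := by
  have hθ : Theta T 1 ≤ 1 := by simpa [Theta] using hT.row_contraction
  have hc : ∀ i j, Commute (star (T i)) (star (T j)) := fun i j => (hT.commute i j).star_star
  obtain ⟨n, ε, hε, hεt⟩ := exists_constTerm hθ
  obtain ⟨L, hL, rfl, hLs⟩ := exists_poisson hc hε
  -- Isometry of (L, R) forces R*R to be this operator.
  set B : H →L[ℂ] H := 1 - ContinuousLinearMap.adjoint L ∘L L with hBdef
  have hB : ∀ h k, inner ℂ (B h) k = inner ℂ h k - inner ℂ (L h) (L k) := fun h k => by
    rw [hBdef, sub_apply, inner_sub_left, ContinuousLinearMap.comp_apply,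
      ContinuousLinearMap.adjoint_inner_left, clm_one_apply]
  have hBpos : B.IsPositive := by
    rw [ContinuousLinearMap.isPositive_iff_complex]
    intro h
    have h1 : inner ℂ (B h) h = ((‖h‖ ^ 2 - ‖L h‖ ^ 2 : ℝ) : ℂ) := by
      rw [hB, inner_self_eq_norm_sq_to_K, inner_self_eq_norm_sq_to_K]
      push_cast
      rfl
    rw [h1]
    refine ⟨congrArg _ (Complex.ofReal_re _), ?_⟩
    have := pow_le_pow_left₀ (norm_nonneg _) (hL h) 2
    change 0 ≤ ((‖h‖ ^ 2 - ‖L h‖ ^ 2 : ℝ) : ℂ).re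
    rw [Complex.ofReal_re]
    linarith
  -- This is Θ_T(B) = B: by `hε` the defect of T cancels that of n·S along L.
  have hiso : ∀ x y, ∑ i, inner ℂ (B (star (T i) x)) (star (T i) y) = inner ℂ (B x) y := by
    intro x y
    have h1 := sum_inner_star_shift (L x) (L y)
    have h2 := hε x y
    rw [sub_apply, inner_sub_left, inner_Theta] at h2
    simp only [clm_one_apply] at h2
    simp only [hLs] at h1
    simp only [hB, Finset.sum_sub_distrib]
    rw [← h1]
    change _ = _ - (_ + inner ℂ (constTerm L x) (constTerm L y))
    rw [h2]
    ring
  obtain ⟨HZ, _, _, _, Z, R, hZ, hR, hRs, hRt⟩ := exists_sphericalUnitary_extension hBpos hc hiso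
  refine ⟨n, HZ, _, _, ‹_›, separableSpace_of_total hRt fun w =>
    ((wordOp Z w).continuous.comp R.continuous), Z, L, R, hZ, hLs, hRs, fun h k => ?_,
    fun M hM h => isReducing_full hZ hεt hRt hM h⟩
  rw [hR, hB]
  ring

end Existence

theorem UnitarilyEquiv.trans {d : ℕ} {E : Type*} [NormedAddCommGroup E] [InnerProductSpace ℂ E]
    {F : Type*} [NormedAddCommGroup F] [InnerProductSpace ℂ F]
    {G : Type*} [NormedAddCommGroup G] [InnerProductSpace ℂ G] {A : Fin d → E →L[ℂ] E}
    {B : Fin d → F →L[ℂ] F} {C : Fin d → G →L[ℂ] G} (h : UnitarilyEquiv A B)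
    (h' : UnitarilyEquiv B C) : UnitarilyEquiv A C := by
  obtain ⟨U, hU⟩ := h
  obtain ⟨V, hV⟩ := h'
  exact ⟨U.trans V, fun i x => by simp [hU, hV]⟩

end DruryArveson

end

theorem mainTheorem6 (d : ℕ) {H : Type u} [NormedAddCommGroup H] [InnerProductSpace ℂ H]
    [CompleteSpace H] [TopologicalSpace.SeparableSpace H]
    (T : Fin d → H →L[ℂ] H) (hT : IsDContraction T) :
    -- existence of a model
    (∃ (n : ℕ∞) (HZ : Type u) (_ : NormedAddCommGroup HZ) (_ : InnerProductSpace ℂ HZ)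
      (_ : CompleteSpace HZ) (_ : TopologicalSpace.SeparableSpace HZ)
      (Z : Fin d → HZ →L[ℂ] HZ) (K : ClosedSubmodule ℂ (ModelSpace d n HZ)),
      IsModel T n Z K) ∧
    -- the unitary equivalence class of `T` determines the triple up to unitary equivalence
    (∀ {H' : Type u'} [NormedAddCommGroup H'] [InnerProductSpace ℂ H'] [CompleteSpace H']
      (T' : Fin d → H' →L[ℂ] H'), UnitarilyEquiv T T' →
      ∀ (n n' : ℕ∞) {HZ : Type v} [NormedAddCommGroup HZ] [InnerProductSpace ℂ HZ]
      [CompleteSpace HZ] {HZ' : Type w} [NormedAddCommGroup HZ'] [InnerProductSpace ℂ HZ']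
      [CompleteSpace HZ'] (Z : Fin d → HZ →L[ℂ] HZ) (Z' : Fin d → HZ' →L[ℂ] HZ')
      (K : ClosedSubmodule ℂ (ModelSpace d n HZ)) (K' : ClosedSubmodule ℂ (ModelSpace d n' HZ')),
      IsModel T n Z K → IsModel T' n' Z' K' → TripleEquiv n Z K n' Z' K') ∧
    -- `Z` is nil iff `T` is pure, and `n` is the rank of `T`
    (∀ (n : ℕ∞) {HZ : Type v} [NormedAddCommGroup HZ] [InnerProductSpace ℂ HZ] [CompleteSpace HZ]
      (Z : Fin d → HZ →L[ℂ] HZ) (K : ClosedSubmodule ℂ (ModelSpace d n HZ)),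
      IsModel T n Z K → (Subsingleton HZ ↔ IsPure T) ∧ n = rank T) := by
  have hθ : Theta T 1 ≤ 1 := by simpa [Theta] using hT.row_contraction
  refine ⟨?_, ?_, ?_⟩
  · obtain ⟨n, HZ, i₁, i₂, i₃, i₄, Z, L, R, hD⟩ := exists_isDilation hT
    obtain ⟨K, hK⟩ := hD.exists_isModel
    exact ⟨n, HZ, i₁, i₂, i₃, i₄, Z, K, hK⟩
  · intro H' _ _ _ T' hTT' n n' HZ _ _ _ HZ' _ _ _ Z Z' K K' hK hK'
    -- A model of T' is also a model of T, so both triples are compared over T.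
    exact hK.tripleEquiv hθ ⟨hK'.spherical, hK'.coinvariant, hK'.full, hTT'.trans hK'.equiv⟩
  · intro n HZ _ _ _ Z K hK
    obtain ⟨L, R, hD, -⟩ := hK.exists_isDilation
    exact ⟨hD.subsingleton_iff_isPure hθ, hD.eq_rank hθ⟩
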